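/- Let $\mathbb T^3=(\mathbb R/2\pi\mathbb Z)^3$, $\hat f(k)=(2\pi)^{-3}\langle f,e^{-ik\cdot x}\rangle$ for $k\in\mathbb Z^3$, and $|k|$ the Euclidean length. Let $X^{-1}$ be the space of (vector-valued) distributions $f$ on $\mathbb T^3$ with $\hat f(0)=0$ and $\|f\|_{X^{-1}}=\sum_{k\ne0}|\hat f(k)|/|k|<\infty$. Let $\mathcal Y$ be the space of distributions $f$ depending on time $t\ge0$, with Fourier coefficients measurable in time, such that $\hat f(t,0)=0$ for all $t\ge 0$ and $$\|f\|_{\mathcal Y}=\sum_{k\neq0}\sup_{t\ge0}\frac{|\hat f(t,k)|}{|k|}+\sum_{k\ne0}\int_0^\infty|k||\hat f(t,k)|\,dt<\infty.$$ Let $\mathbb P=\mathbb I-\nabla\Delta^{-1}\mathrm{div}$. A mild solution of the incompressible Navier–Stokes equations with viscosity $\mu>0$ and initial data $v_0\in X^{-1}$ is a $v\in\mathcal Y$ with $$v(t)=e^{\mu t\Delta}v_0-\int_0^te^{\mu(t-s)\Delta}\,\mathbb P\,\mathrm{div}(v\otimes v)(s)\,ds\qquad(t\ge0).$$ Theorem.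 Let $\mu>0$. There are constants $K\ge 0$ and $\delta>0$, depending only on $\mu$, such that for every $\alpha\in(0,1)$ there are $C\ge 0$ and $\varepsilon_0>0$, depending only on $\mu$ and $\alpha$, with the following property. For every $v_0\in X^{-1}$ with $\|v_0\|_{X^{-1}}<\varepsilon_0$ there is a unique mild solution $v$ with initial data $v_0$ and $\|v\|_{\mathcal Y}<\delta$; it satisfies $\|v\|_{\mathcal Y}\le K\|v_0\|_{X^{-1}}$, the fields $e^{\mu\sqrt t|D|}v$ and $e^{\alpha\mu t|D|}v$ belong to $\mathcal Y$, and $$\|e^{\mu\sqrt t|D|}v\|_{\mathcal Y}+\|e^{\alpha\mu t|D|}v\|_{\mathcal Y}\le C\|v_0\|_{X^{-1}},$$ where $|D|$ is the operator with Fourier multiplier $|k_1|+|k_2|+|k_3|$. Moreover, for every $t>0$, $v(t)$ is real-analytic in space with radius of analyticity at least $R=\max\{\mu\sqrt t,\alpha\mu t\}$: it extends to a holomorphic function on the tube $\{z\in\mathbb C^3:|\mathrm{Im}\,z_j|<R,\ j=1,2,3\}$. -/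

import Mathlib

open scoped NNReal ENNReal ContDiff

noncomputable section

/-- Test functions on the torus `𝕋³ = (ℝ/2πℤ)³`: smooth functions on `ℝ³`, `2π`-periodic in each
variable. -/
def torusTest : Submodule ℂ ((Fin 3 → ℝ) → ℂ) where
  carrier := {φ | ContDiff ℝ ∞ φ ∧
    ∀ (x : Fin 3 → ℝ) (j : Fin 3), φ (x + Pi.single j (2 * Real.pi)) = φ x}
  add_mem' := by
    rintro φ ψ ⟨h1, h2⟩ ⟨h3, h4⟩
    exact ⟨h1.add h3, fun x j => by simp [h2 x j, h4 x j]⟩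
  zero_mem' := ⟨contDiff_const, fun _ _ => rfl⟩
  smul_mem' := by
    rintro c φ ⟨h1, h2⟩
    exact ⟨h1.const_smul c, fun x j => by simp [h2 x j]⟩

/-- Distributions on `𝕋³`: linear functionals on the test functions that are continuous for the
`C^∞` topology, that is, bounded by a constant times some `C^N` norm. -/
@[ext]
structure TorusDistribution where
  toLinearMap : torusTest →ₗ[ℂ] ℂ
  bounded : ∃ (N : ℕ) (C : ℝ), ∀ (φ : torusTest) (M : ℝ),
    (∀ n ≤ N, ∀ x, ‖iteratedFDeriv ℝ n (φ : (Fin 3 → ℝ) → ℂ) x‖ ≤ M) →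
      ‖toLinearMap φ‖ ≤ C * M

/-- The character `x ↦ e^{i k·x}`. -/
def torusChar (k : Fin 3 → ℤ) (x : Fin 3 → ℝ) : ℂ :=
  Complex.exp (Complex.I * ((∑ j, (k j : ℝ) * x j : ℝ) : ℂ))

theorem torusChar_mem (k : Fin 3 → ℤ) : torusChar k ∈ torusTest := by
  refine ⟨?_, fun x j => ?_⟩
  · unfold torusChar
    refine Complex.contDiff_exp.comp (contDiff_const.mul (Complex.ofRealCLM.contDiff.comp ?_))
    exact ContDiff.sum (s := Finset.univ) (f := fun j (x : Fin 3 → ℝ) => (k j : ℝ) * x j)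
      fun j _ => contDiff_const.mul (contDiff_apply ℝ ℝ j)
  · have h : (∑ i, (k i : ℝ) * (x + Pi.single j (2 * Real.pi) : Fin 3 → ℝ) i)
        = (∑ i, (k i : ℝ) * x i) + (k j : ℝ) * (2 * Real.pi) := by
      simp [mul_add, Finset.sum_add_distrib, Pi.single_apply]
    unfold torusChar
    rw [h, Complex.exp_eq_exp_iff_exists_int]
    exact ⟨k j, by push_cast; ring⟩

/-- Fourier coefficients `f̂(k) = (2π)⁻³ ⟨f, e^{-i k·x}⟩`. -/
def TorusDistribution.coeff (f : TorusDistribution) (k : Fin 3 → ℤ) : ℂ :=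
  ((2 * Real.pi : ℝ) : ℂ)⁻¹ ^ 3 * f.toLinearMap ⟨torusChar (-k), torusChar_mem (-k)⟩

/-- Vector-valued distributions on `𝕋³`. -/
abbrev TorusField := Fin 3 → TorusDistribution

/-- The `k`-th Fourier coefficient of a vector-valued distribution, in `ℂ³`. -/
def TorusField.coeff (f : TorusField) (k : Fin 3 → ℤ) : EuclideanSpace ℂ (Fin 3) :=
  WithLp.toLp 2 fun i => TorusDistribution.coeff (f i) k

/-- The Euclidean length `|k|` of a lattice vector. -/
def freq (k : Fin 3 → ℤ) : ℝ := Real.sqrt (∑ j, (k j : ℝ) ^ 2)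

/-- The symbol `|k₁| + |k₂| + |k₃|` of the operator `|D|`. -/
def freqOne (k : Fin 3 → ℤ) : ℝ := ∑ j, |(k j : ℝ)|

/-- `‖f‖_{X⁻¹} = ∑_{k ≠ 0} |f̂(k)| / |k|`, with value `∞` if the series diverges. -/
def normX (f : TorusField) : ℝ≥0∞ :=
  ∑' k : {k : Fin 3 → ℤ // k ≠ 0}, ENNReal.ofReal (‖f.coeff k‖ / freq k)

/-- The space `X⁻¹`. -/
def MemX (f : TorusField) : Prop := f.coeff 0 = 0 ∧ normX f < ⊤

/-- The `𝒳⁻¹` norm `∑_{k ≠ 0} sup_{t ≥ 0} |f̂(t,k)| / |k|` of a field depending on time `t ≥ 0`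
(values at negative times are ignored throughout). -/
def normXSup (f : ℝ → TorusField) : ℝ≥0∞ :=
  ∑' k : {k : Fin 3 → ℤ // k ≠ 0},
    ⨆ t : Set.Ici (0 : ℝ), ENNReal.ofReal (‖(f t).coeff k‖ / freq k)

/-- The `𝒳¹` norm `∑_{k ≠ 0} ∫_0^∞ |k| |f̂(t,k)| dt`. -/
def normXInt (f : ℝ → TorusField) : ℝ≥0∞ :=
  ∑' k : {k : Fin 3 → ℤ // k ≠ 0},
    ∫⁻ t in Set.Ici (0 : ℝ), ENNReal.ofReal (freq k * ‖(f t).coeff k‖)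

/-- The norm of `𝒴 = 𝒳⁻¹ ∩ 𝒳¹`. -/
def normY (f : ℝ → TorusField) : ℝ≥0∞ := normXSup f + normXInt f

/-- The space `𝒴 = 𝒳⁻¹ ∩ 𝒳¹`. -/
structure MemY (f : ℝ → TorusField) : Prop where
  aemeasurable : ∀ k, AEMeasurable (fun t => (f t).coeff k)
    (MeasureTheory.volume.restrict (Set.Ici (0 : ℝ)))
  coeff_zero : ∀ t, 0 ≤ t → (f t).coeff 0 = 0
  normY_lt_top : normY f < ⊤

/-- Fourier coefficients of the products `f_i f_j`: `∑_ℓ f̂_i(ℓ) f̂_j(k-ℓ)`. -/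
def tensorCoeff (f : TorusField) (k : Fin 3 → ℤ) (i j : Fin 3) : ℂ :=
  ∑' l : Fin 3 → ℤ, (f i).coeff l * (f j).coeff (k - l)

/-- Fourier coefficients of `div (f ⊗ f)`, whose `i`-th component is `∑_j ∂_j (f_i f_j)`. -/
def divTensorCoeff (f : TorusField) (k : Fin 3 → ℤ) (i : Fin 3) : ℂ :=
  ∑ j, Complex.I * (k j : ℂ) * tensorCoeff f k i j

/-- The action of the Leray projector `ℙ = I - ∇Δ⁻¹div` on the `k`-th Fourier coefficient:
`w ↦ w - k (k·w) / |k|²`. -/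
def leraySymbol (k : Fin 3 → ℤ) (w : Fin 3 → ℂ) (i : Fin 3) : ℂ :=
  w i - (k i : ℂ) * (∑ j, (k j : ℂ) * w j) / ((freq k ^ 2 : ℝ) : ℂ)

/-- `v ∈ 𝒴` is a mild solution of the Navier-Stokes equations with viscosity `μ` and initial data
`v₀`: for all `t ≥ 0`, `v(t) = e^{μtΔ} v₀ - ∫_0^t e^{μ(t-s)Δ} [ℙ div (v ⊗ v)(s)] ds`, written out
for every Fourier coefficient. -/
structure IsMildSolution (μ : ℝ) (v₀ : TorusField) (v : ℝ → TorusField) : Prop where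
  memY : MemY v
  formula : ∀ t : ℝ, 0 ≤ t → ∀ (k : Fin 3 → ℤ) (i : Fin 3),
    (v t i).coeff k = (Real.exp (-(μ * t * freq k ^ 2)) : ℂ) * (v₀ i).coeff k
      - ∫ s in (0 : ℝ)..t, (Real.exp (-(μ * (t - s) * freq k ^ 2)) : ℂ)
          * leraySymbol k (divTensorCoeff (v s) k) i

/-- `V = e^{ρ(t)|D|} v` for all `t ≥ 0`. -/
def IsExpD (ρ : ℝ → ℝ) (v V : ℝ → TorusField) : Prop :=
  ∀ t : ℝ, 0 ≤ t → ∀ k : Fin 3 → ℤ,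
    (V t).coeff k = (Real.exp (ρ t * freqOne k) : ℂ) • (v t).coeff k

/-- The distribution `f` is (integration against) the continuous periodic function `u`. -/
def TorusDistribution.IsFunction (f : TorusDistribution) (u : (Fin 3 → ℝ) → ℂ) : Prop :=
  Continuous u ∧ (∀ (x : Fin 3 → ℝ) (j : Fin 3), u (x + Pi.single j (2 * Real.pi)) = u x) ∧
    ∀ φ : torusTest, f.toLinearMap φ =
      ∫ x in Set.Icc (0 : Fin 3 → ℝ) (fun _ => 2 * Real.pi), u x * (φ : (Fin 3 → ℝ) → ℂ) x

/-- For `R > 0`: `f` is a real-analytic function with radius of analyticity at least `R`, that is,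
it extends holomorphically to the complex tube `{z ∈ ℂ³ : |Im z_j| < R for all j}`. -/
def TorusDistribution.AnalyticWithRadius (f : TorusDistribution) (R : ℝ) : Prop :=
  ∃ U : (Fin 3 → ℂ) → ℂ, DifferentiableOn ℂ U {z | ∀ j, |(z j).im| < R} ∧
    f.IsFunction fun x => U fun j => (x j : ℂ)

end

/-! The mild equation is a fixed point problem for the Fourier coefficients, and $\mathcal Y$ is
scaled so that its quadratic term is bounded. In $\sum_l \hat f(l)\hat g(k-l)$ the factor of lower
frequency is put in the supremum part of the norm and the other in the integral part; since
$|l|\le|m|$ lets $|l|$ be replaced by $|m|$, this gives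
$\sum_k\int|\widehat{fg}(t,k)|\,dt\le\|f\|_{\mathcal Y}\|g\|_{\mathcal Y}$
(`tsum_lintegral_freqConv_le`). The heat kernel then recovers the derivative lost to the divergence
(`yNorm_duhamel_le`), so Picard iteration contracts for small data, which gives existence and
uniqueness.

For analyticity the coefficients carry the weight $e^{\rho(t)|k|_1}$. It is submultiplicative in
$k$, so it passes through convolutions, and its growth between times $s$ and $t$ is paid for by part
of the dissipation $e^{-\mu(t-s)|k|^2}$ (`IsAbsorbed`). For $\rho=\mu\sqrt t$ this is the inequality
between arithmetic and geometric means; for $\rho=\alpha\mu t$ it is $|k|_1\le|k|^2$ on the integer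
lattice. The same Picard iterates are therefore bounded in the weighted norms, and the bounds pass
to the limit by Fatou's lemma (`yNorm_le_of_tendsto`); no contraction in a weighted norm is needed.

These estimates concern moduli valued in `ℝ≥0∞`, where sums and integrals always exist. The return
to distributions rests on two facts: a distribution is determined by its coefficients
(`TorusDistribution.ext_coeff`), and coefficients with $\sum|c_k|/|k|<\infty$ and $c_0=0$ define one
(`TorusDistribution.ofIsCoeff`). Exponential decay of the coefficients makes the Fourier series
holomorphic in a tube. -/

/-! ### Norms of moduli of Fourier coefficients; the bilinear and Duhamel estimates. -/

section Estimates

open MeasureTheory Filter Topology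

/-- Lebesgue measure on the half line of nonnegative times. -/
noncomputable abbrev timeMeasure : Measure ℝ := volume.restrict (Set.Ici (0 : ℝ))

/-- The Euclidean length of a lattice vector as an extended nonnegative real. -/
noncomputable def efreq (k : Fin 3 → ℤ) : ℝ≥0∞ := ENNReal.ofReal (freq k)

theorem freq_sq (k : Fin 3 → ℤ) : freq k ^ 2 = ∑ j, (k j : ℝ) ^ 2 :=
  Real.sq_sqrt (Finset.sum_nonneg fun _ _ => sq_nonneg _)

theorem freq_nonneg (k : Fin 3 → ℤ) : 0 ≤ freq k := Real.sqrt_nonneg _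

theorem freq_zero : freq 0 = 0 := by simp [freq]

theorem freqOne_nonneg (k : Fin 3 → ℤ) : 0 ≤ freqOne k :=
  Finset.sum_nonneg fun _ _ => abs_nonneg _

theorem abs_le_freq (k : Fin 3 → ℤ) (j : Fin 3) : |(k j : ℝ)| ≤ freq k := by
  rw [← Real.sqrt_sq_eq_abs]
  exact Real.sqrt_le_sqrt (Finset.single_le_sum (f := fun j => (k j : ℝ) ^ 2)
    (fun _ _ => sq_nonneg _) (Finset.mem_univ j))

theorem freq_pos {k : Fin 3 → ℤ} (hk : k ≠ 0) : 0 < freq k := by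
  obtain ⟨j, hj⟩ := Function.ne_iff.1 hk
  exact lt_of_lt_of_le (abs_pos.2 (by exact_mod_cast hj)) (abs_le_freq k j)

theorem one_le_freq {k : Fin 3 → ℤ} (hk : k ≠ 0) : 1 ≤ freq k := by
  obtain ⟨j, hj⟩ := Function.ne_iff.1 hk
  refine le_trans ?_ (abs_le_freq k j)
  exact_mod_cast Int.one_le_abs hj

theorem freq_le_freqOne (k : Fin 3 → ℤ) : freq k ≤ freqOne k := by
  refine Real.sqrt_le_iff.2 ⟨freqOne_nonneg k, ?_⟩
  simp only [freqOne, Fin.sum_univ_three]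
  nlinarith [sq_abs (k 0 : ℝ), sq_abs (k 1 : ℝ), sq_abs (k 2 : ℝ), abs_nonneg (k 0 : ℝ),
    abs_nonneg (k 1 : ℝ), abs_nonneg (k 2 : ℝ),
    mul_nonneg (abs_nonneg (k 0 : ℝ)) (abs_nonneg (k 1 : ℝ)),
    mul_nonneg (abs_nonneg (k 0 : ℝ)) (abs_nonneg (k 2 : ℝ)),
    mul_nonneg (abs_nonneg (k 1 : ℝ)) (abs_nonneg (k 2 : ℝ))]

/-- An integer satisfies $|n|\le n^2$; this discreteness of the frequencies is what allows a weight
growing linearly in time. -/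
theorem freqOne_le_freq_sq (k : Fin 3 → ℤ) : freqOne k ≤ freq k ^ 2 := by
  rw [freq_sq]
  refine Finset.sum_le_sum fun j _ => ?_
  have : |k j| ≤ (k j) ^ 2 := by
    rcases eq_or_ne (k j) 0 with h | h
    · simp [h]
    · nlinarith [Int.one_le_abs h, sq_abs (k j)]
  exact_mod_cast this

theorem freqOne_sq_le (k : Fin 3 → ℤ) : freqOne k ^ 2 ≤ 3 * freq k ^ 2 := by
  rw [freq_sq]
  simp only [freqOne, Fin.sum_univ_three]
  nlinarith [sq_abs (k 0 : ℝ), sq_abs (k 1 : ℝ), sq_abs (k 2 : ℝ),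
    sq_nonneg (|(k 0 : ℝ)| - |(k 1 : ℝ)|), sq_nonneg (|(k 0 : ℝ)| - |(k 2 : ℝ)|),
    sq_nonneg (|(k 1 : ℝ)| - |(k 2 : ℝ)|)]

theorem freqOne_add_le (k l : Fin 3 → ℤ) : freqOne (k + l) ≤ freqOne k + freqOne l := by
  rw [freqOne, freqOne, freqOne, ← Finset.sum_add_distrib]
  exact Finset.sum_le_sum fun j _ => by simpa using abs_add_le (k j : ℝ) (l j)

theorem efreq_ne_top (k : Fin 3 → ℤ) : efreq k ≠ ⊤ := ENNReal.ofReal_ne_top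

theorem efreq_ne_zero {k : Fin 3 → ℤ} (hk : k ≠ 0) : efreq k ≠ 0 := by
  simpa [efreq] using freq_pos hk

/-- The `𝒳⁻¹` part of the `𝒴` norm of a family of moduli of Fourier coefficients. -/
noncomputable def supNorm (g : ℝ → (Fin 3 → ℤ) → ℝ≥0∞) : ℝ≥0∞ :=
  ∑' k : {k : Fin 3 → ℤ // k ≠ 0}, ⨆ t : Set.Ici (0 : ℝ), g t k / efreq k

/-- The `𝒳¹` part of the `𝒴` norm of a family of moduli of Fourier coefficients. -/
noncomputable def intNorm (g : ℝ → (Fin 3 → ℤ) → ℝ≥0∞) : ℝ≥0∞ :=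
  ∑' k : {k : Fin 3 → ℤ // k ≠ 0}, ∫⁻ t, efreq k * g t k ∂timeMeasure

/-- The `𝒴` norm of a family of moduli of Fourier coefficients. -/
noncomputable def yNorm (g : ℝ → (Fin 3 → ℤ) → ℝ≥0∞) : ℝ≥0∞ := supNorm g + intNorm g

theorem yNorm_mono {g h : ℝ → (Fin 3 → ℤ) → ℝ≥0∞} (H : ∀ t, 0 ≤ t → ∀ k, k ≠ 0 → g t k ≤ h t k) :
    yNorm g ≤ yNorm h := by
  refine add_le_add (ENNReal.tsum_le_tsum fun k => ?_) (ENNReal.tsum_le_tsum fun k => ?_)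
  · exact iSup_mono fun t => ENNReal.div_le_div_right (H t t.2 k k.2) _
  · exact setLIntegral_mono' measurableSet_Ici fun t ht => by gcongr; exact H t ht k k.2

theorem yNorm_const_mul {c : ℝ≥0∞} (hc : c ≠ ⊤) (g : ℝ → (Fin 3 → ℤ) → ℝ≥0∞) :
    yNorm (fun t k => c * g t k) = c * yNorm g := by
  simp only [yNorm, supNorm, intNorm, mul_add, ← ENNReal.tsum_mul_left, ENNReal.mul_iSup,
    mul_div_assoc, mul_left_comm _ c, lintegral_const_mul' c _ hc]

theorem yNorm_add_le {g : ℝ → (Fin 3 → ℤ) → ℝ≥0∞} (h : ℝ → (Fin 3 → ℤ) → ℝ≥0∞)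
    (hg : ∀ k, AEMeasurable (fun t => g t k) timeMeasure) :
    yNorm (fun t k => g t k + h t k) ≤ yNorm g + yNorm h := by
  have h1 : supNorm (fun t k => g t k + h t k) ≤ supNorm g + supNorm h := by
    rw [supNorm, supNorm, supNorm, ← ENNReal.tsum_add]
    refine ENNReal.tsum_le_tsum fun k => iSup_le fun t => ?_
    rw [ENNReal.add_div]
    exact add_le_add (le_iSup (fun t : Set.Ici (0 : ℝ) => g t k / efreq k) t)
      (le_iSup (fun t : Set.Ici (0 : ℝ) => h t k / efreq k) t)
  have h2 : intNorm (fun t k => g t k + h t k) ≤ intNorm g + intNorm h := by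
    rw [intNorm, intNorm, intNorm, ← ENNReal.tsum_add]
    refine ENNReal.tsum_le_tsum fun k => ?_
    simp only [mul_add]
    rw [lintegral_add_left' ((hg k).const_mul _)]
  calc _ ≤ (supNorm g + supNorm h) + (intNorm g + intNorm h) := add_le_add h1 h2
    _ = _ := by rw [yNorm, yNorm]; abel

theorem liminf_add_liminf_le (u v : ℕ → ℝ≥0∞) :
    liminf u atTop + liminf v atTop ≤ liminf (fun n => u n + v n) atTop := by
  simp only [liminf_eq_iSup_iInf_of_nat]
  rw [ENNReal.iSup_add_iSup_of_monotone]
  · exact iSup_mono fun n => le_iInf₂ fun i hi => add_le_add (iInf₂_le i hi) (iInf₂_le i hi)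
  · exact fun m n hmn => biInf_mono fun i hi => le_trans hmn hi
  · exact fun m n hmn => biInf_mono fun i hi => le_trans hmn hi

/-- Fatou's lemma for the counting measure. -/
theorem tsum_liminf_le {ι : Type*} (u : ℕ → ι → ℝ≥0∞) :
    ∑' i, liminf (fun n => u n i) atTop ≤ liminf (fun n => ∑' i, u n i) atTop := by
  let _ : MeasurableSpace ι := ⊤
  simpa only [lintegral_count] using
    lintegral_liminf_le (μ := Measure.count) (f := u) (u := atTop) fun n => measurable_from_top

/-- Fatou's lemma for the `𝒴` norm. -/
theorem yNorm_le_of_tendsto {g : ℕ → ℝ → (Fin 3 → ℤ) → ℝ≥0∞} {h : ℝ → (Fin 3 → ℤ) → ℝ≥0∞}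
    {M : ℝ≥0∞} (hg : ∀ n k, AEMeasurable (fun t => g n t k) timeMeasure)
    (hlim : ∀ t, 0 ≤ t → ∀ k, Tendsto (fun n => g n t k) atTop (𝓝 (h t k)))
    (hM : ∀ᶠ n in atTop, yNorm (g n) ≤ M) : yNorm h ≤ M := by
  have h1 : supNorm h ≤ liminf (fun n => supNorm (g n)) atTop := by
    refine le_trans (ENNReal.tsum_le_tsum fun k => ?_) (tsum_liminf_le _)
    refine iSup_le fun t => ?_
    have := ENNReal.Tendsto.div_const (hlim t t.2 k) (.inr (efreq_ne_zero k.2))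
    rw [← this.liminf_eq]
    exact liminf_le_liminf (.of_forall fun n =>
      le_iSup (fun t : Set.Ici (0 : ℝ) => g n t k / efreq k) t)
  have h2 : intNorm h ≤ liminf (fun n => intNorm (g n)) atTop := by
    refine le_trans (ENNReal.tsum_le_tsum fun k => ?_) (tsum_liminf_le _)
    refine le_trans (setLIntegral_mono' measurableSet_Ici fun t ht => ?_)
      (lintegral_liminf_le' fun n => (hg n k).const_mul (efreq k))
    exact (ENNReal.Tendsto.const_mul (hlim t ht k) (.inr (efreq_ne_top k))).liminf_eq.ge
  calc yNorm h ≤ _ := add_le_add h1 h2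
    _ ≤ liminf (fun n => yNorm (g n)) atTop := liminf_add_liminf_le _ _
    _ ≤ M := liminf_le_of_frequently_le' hM.frequently

theorem div_le_supNorm (g : ℝ → (Fin 3 → ℤ) → ℝ≥0∞) {t : ℝ} (ht : 0 ≤ t) {k : Fin 3 → ℤ}
    (hk : k ≠ 0) : g t k / efreq k ≤ supNorm g :=
  le_trans (le_iSup (fun t : Set.Ici (0 : ℝ) => g t k / efreq k) ⟨t, ht⟩)
    (ENNReal.le_tsum (f := fun k : {k : Fin 3 → ℤ // k ≠ 0} =>
      ⨆ t : Set.Ici (0 : ℝ), g t k / efreq k) ⟨k, hk⟩)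

theorem le_efreq_mul_yNorm (g : ℝ → (Fin 3 → ℤ) → ℝ≥0∞) {t : ℝ} (ht : 0 ≤ t) {k : Fin 3 → ℤ}
    (hk : k ≠ 0) : g t k ≤ efreq k * yNorm g := by
  have := (div_le_supNorm g ht hk).trans (le_self_add : _ ≤ yNorm g)
  rwa [ENNReal.div_le_iff (efreq_ne_zero hk) (efreq_ne_top k), mul_comm] at this

theorem tsum_div_efreq_le (g : ℝ → (Fin 3 → ℤ) → ℝ≥0∞) {t : ℝ} (ht : 0 ≤ t) :
    ∑' k : {k : Fin 3 → ℤ // k ≠ 0}, g t k / efreq k ≤ yNorm g :=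
  le_trans (ENNReal.tsum_le_tsum fun k =>
    le_iSup (fun t : Set.Ici (0 : ℝ) => g t k / efreq k) ⟨t, ht⟩) le_self_add

theorem tsum_ne_zero_eq_tsum (f : (Fin 3 → ℤ) → ℝ≥0∞) (h0 : f 0 = 0) :
    ∑' k : {k : Fin 3 → ℤ // k ≠ 0}, f k = ∑' k, f k := by
  refine tsum_subtype_eq_of_support_subset (s := {k | k ≠ 0}) fun k hk hk0 => hk ?_
  rw [hk0, h0]

/-- Discrete convolution in the frequency variable. -/
noncomputable def freqConv (g h : ℝ → (Fin 3 → ℤ) → ℝ≥0∞) (t : ℝ) (k : Fin 3 → ℤ) : ℝ≥0∞ :=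
  ∑' l, g t l * h t (k - l)

theorem aemeasurable_freqConv {g h : ℝ → (Fin 3 → ℤ) → ℝ≥0∞}
    (hg : ∀ k, AEMeasurable (fun t => g t k) timeMeasure)
    (hh : ∀ k, AEMeasurable (fun t => h t k) timeMeasure) (k : Fin 3 → ℤ) :
    AEMeasurable (fun t => freqConv g h t k) timeMeasure :=
  AEMeasurable.tsum fun l => (hg l).mul (hh (k - l))

/-- If $|l|\le|m|$, write $g_lh_m=(g_l/|l|)(|l|h_m)\le(\sup g_l/|l|)\,|m|h_m$ and integrate;
otherwise exchange the roles. The sum of both outcomes covers the two cases. -/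
theorem lintegral_mul_le {g h : ℝ → (Fin 3 → ℤ) → ℝ≥0∞}
    (hg : ∀ k, AEMeasurable (fun t => g t k) timeMeasure)
    (hh : ∀ k, AEMeasurable (fun t => h t k) timeMeasure)
    {l m : Fin 3 → ℤ} (hl : l ≠ 0) (hm : m ≠ 0) :
    ∫⁻ t, g t l * h t m ∂timeMeasure ≤
      (⨆ t : Set.Ici (0 : ℝ), g t l / efreq l) * (∫⁻ t, efreq m * h t m ∂timeMeasure) +
      (∫⁻ t, efreq l * g t l ∂timeMeasure) * (⨆ t : Set.Ici (0 : ℝ), h t m / efreq m) := by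
  have key : ∀ {a b : ℝ → (Fin 3 → ℤ) → ℝ≥0∞} {p q : Fin 3 → ℤ},
      (∀ k, AEMeasurable (fun t => b t k) timeMeasure) → p ≠ 0 → efreq p ≤ efreq q →
      ∫⁻ t, a t p * b t q ∂timeMeasure ≤
        (⨆ t : Set.Ici (0 : ℝ), a t p / efreq p) * (∫⁻ t, efreq q * b t q ∂timeMeasure) := by
    intro a b p q hb hp hpq
    rw [← lintegral_const_mul'' _ ((hb q).const_mul _)]
    refine setLIntegral_mono' measurableSet_Ici fun t ht => ?_
    calc a t p * b t q = a t p / efreq p * (efreq p * b t q) := by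
          rw [← mul_assoc, ENNReal.div_mul_cancel (efreq_ne_zero hp) (efreq_ne_top p)]
      _ ≤ _ := by
          gcongr
          exact le_iSup (fun t : Set.Ici (0 : ℝ) => a t p / efreq p) ⟨t, ht⟩
  rcases le_total (efreq l) (efreq m) with H | H
  · exact (key hh hl H).trans le_self_add
  · have := key (a := h) hg hm H
    simp only [mul_comm (h _ m)] at this
    rw [mul_comm (lintegral _ _)]
    exact this.trans le_add_self

/-- The substitution $m=k-l$ turns the convolution into a sum over all pairs $(l,m)$, where the
pairwise bound splits into products of single sums. -/
theorem tsum_lintegral_freqConv_le {g h : ℝ → (Fin 3 → ℤ) → ℝ≥0∞}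
    (hg : ∀ k, AEMeasurable (fun t => g t k) timeMeasure)
    (hh : ∀ k, AEMeasurable (fun t => h t k) timeMeasure)
    (hg0 : ∀ t, 0 ≤ t → g t 0 = 0) (hh0 : ∀ t, 0 ≤ t → h t 0 = 0) :
    ∑' k, ∫⁻ t, freqConv g h t k ∂timeMeasure ≤ yNorm g * yNorm h := by
  have hz : ∀ l m, (l = 0 ∨ m = 0) → ∫⁻ t, g t l * h t m ∂timeMeasure = 0 := by
    intro l m hlm
    refine (setLIntegral_congr_fun measurableSet_Ici fun t ht => ?_).trans lintegral_zero
    rcases hlm with rfl | rfl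
    · simp [hg0 t ht]
    · simp [hh0 t ht]
  calc ∑' k, ∫⁻ t, freqConv g h t k ∂timeMeasure
      = ∑' k, ∑' l, ∫⁻ t, g t l * h t (k - l) ∂timeMeasure := by
        refine tsum_congr fun k => ?_
        exact lintegral_tsum fun l => (hg l).mul (hh (k - l))
    _ = ∑' l, ∑' k, ∫⁻ t, g t l * h t (k - l) ∂timeMeasure := ENNReal.tsum_comm
    _ = ∑' l, ∑' m, ∫⁻ t, g t l * h t m ∂timeMeasure := by
        refine tsum_congr fun l => ?_
        exact (Equiv.subRight l).tsum_eq (fun m => ∫⁻ t, g t l * h t m ∂timeMeasure)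
    _ = ∑' l : {k : Fin 3 → ℤ // k ≠ 0}, ∑' m : {k : Fin 3 → ℤ // k ≠ 0},
          ∫⁻ t, g t l * h t m ∂timeMeasure := by
        rw [← tsum_ne_zero_eq_tsum _ (by simp [hz])]
        exact tsum_congr fun l => (tsum_ne_zero_eq_tsum _ (hz _ _ (.inr rfl))).symm
    _ ≤ ∑' l : {k : Fin 3 → ℤ // k ≠ 0}, ∑' m : {k : Fin 3 → ℤ // k ≠ 0},
          ((⨆ t : Set.Ici (0 : ℝ), g t l / efreq l) * (∫⁻ t, efreq m * h t m ∂timeMeasure) +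
          (∫⁻ t, efreq l * g t l ∂timeMeasure) * (⨆ t : Set.Ici (0 : ℝ), h t m / efreq m)) :=
        ENNReal.tsum_le_tsum fun l => ENNReal.tsum_le_tsum fun m =>
          lintegral_mul_le hg hh l.2 m.2
    _ = supNorm g * intNorm h + intNorm g * supNorm h := by
        simp only [ENNReal.tsum_add, ENNReal.tsum_mul_left, ENNReal.tsum_mul_right]
        rfl
    _ ≤ yNorm g * yNorm h := by
        rw [yNorm, yNorm, mul_add, add_mul, add_mul]
        calc _ ≤ supNorm g * intNorm h + intNorm g * supNorm h
              + (supNorm g * supNorm h + intNorm g * intNorm h) := le_self_add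
          _ = _ := by abel

/-- The modulus of the Duhamel integral. -/
noncomputable def duhamel (r : ℝ) (g : ℝ → (Fin 3 → ℤ) → ℝ≥0∞) (t : ℝ) (k : Fin 3 → ℤ) : ℝ≥0∞ :=
  ∫⁻ s in Set.Ioc 0 t, ENNReal.ofReal (Real.exp (-(r * (t - s) * freq k ^ 2))) * g s k

theorem lintegral_exp_decay {b : ℝ} (hb : 0 < b) (s : ℝ) :
    ∫⁻ t in Set.Ici s, ENNReal.ofReal (Real.exp (-(b * (t - s)))) = ENNReal.ofReal (1 / b) := by
  have h : ∀ t, Real.exp (-(b * (t - s))) = Real.exp (b * s) * Real.exp (-b * t) := fun t => by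
    rw [← Real.exp_add]; ring_nf
  have hi : IntegrableOn (fun t => Real.exp (-(b * (t - s)))) (Set.Ioi s) := by
    simp only [h]
    exact (integrableOn_exp_mul_Ioi (by linarith : -b < 0) s).const_mul _
  rw [← restrict_Ioi_eq_restrict_Ici, ← ofReal_integral_eq_lintegral_ofReal hi
    (.of_forall fun _ => (Real.exp_pos _).le)]
  simp only [h]
  rw [integral_const_mul, integral_exp_mul_Ioi (by linarith) s]
  congr 1
  have : Real.exp (b * s) * Real.exp (-b * s) = 1 := by rw [← Real.exp_add]; simp
  field_simp
  simpa using this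

/-- Young's inequality in time: by Tonelli the kernel contributes its total mass $1/(r|k|^2)$. -/
theorem lintegral_duhamel_le {r : ℝ} (hr : 0 < r) {g : ℝ → (Fin 3 → ℤ) → ℝ≥0∞} {k : Fin 3 → ℤ}
    (hk : k ≠ 0) (hg : AEMeasurable (fun t => g t k) timeMeasure) :
    ∫⁻ t, duhamel r g t k ∂timeMeasure ≤
      ENNReal.ofReal (1 / (r * freq k ^ 2)) * ∫⁻ s, g s k ∂timeMeasure := by
  have hb : 0 < r * freq k ^ 2 := mul_pos hr (pow_pos (freq_pos hk) 2)
  -- The indicator encodes $s\le t$, so that the domain of integration no longer depends on $t$.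
  set F : ℝ → ℝ → ℝ≥0∞ := fun t s => (Set.Ici (0 : ℝ)).indicator (fun u =>
    ENNReal.ofReal (Real.exp (-(r * freq k ^ 2 * u)))) (t - s) * g s k with hF
  have h1 : ∀ t, duhamel r g t k ≤ ∫⁻ s, F t s ∂timeMeasure := by
    intro t
    calc duhamel r g t k = ∫⁻ s in Set.Ioc 0 t, F t s := by
          refine setLIntegral_congr_fun measurableSet_Ioc fun s hs => ?_
          simp only [hF]
          rw [Set.indicator_of_mem (by simpa using hs.2)]
          congr 4; ring
      _ ≤ ∫⁻ s, F t s ∂timeMeasure := lintegral_mono_set fun s hs => hs.1.le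
  have hm : AEMeasurable (Function.uncurry F) (timeMeasure.prod timeMeasure) := by
    refine AEMeasurable.mul (Measurable.aemeasurable ?_) hg.comp_snd
    have : Measurable ((Set.Ici (0 : ℝ)).indicator (fun u =>
      ENNReal.ofReal (Real.exp (-(r * freq k ^ 2 * u))))) :=
      Measurable.indicator (by fun_prop) measurableSet_Ici
    exact this.comp (measurable_fst.sub measurable_snd)
  calc ∫⁻ t, duhamel r g t k ∂timeMeasure
      ≤ ∫⁻ t, ∫⁻ s, F t s ∂timeMeasure ∂timeMeasure := lintegral_mono h1
    _ = ∫⁻ s, ∫⁻ t, F t s ∂timeMeasure ∂timeMeasure := lintegral_lintegral_swap hm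
    _ ≤ ∫⁻ s, ENNReal.ofReal (1 / (r * freq k ^ 2)) * g s k ∂timeMeasure := by
        refine lintegral_mono fun s => ?_
        simp only [hF]
        have hms : Measurable fun t => (Set.Ici (0 : ℝ)).indicator (fun u =>
            ENNReal.ofReal (Real.exp (-(r * freq k ^ 2 * u)))) (t - s) :=
          (Measurable.indicator (by fun_prop) measurableSet_Ici).comp (measurable_id.sub_const s)
        rw [lintegral_mul_const _ hms]
        refine mul_le_mul_left ?_ _
        rw [← lintegral_exp_decay hb s]
        refine le_trans (setLIntegral_le_lintegral _ _) ?_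
        rw [← lintegral_indicator measurableSet_Ici]
        refine lintegral_mono fun t => ?_
        simp [Set.indicator_apply]
    _ = _ := lintegral_const_mul'' _ hg

/-- In the supremum part the factor $|k|$ cancels the division by $|k|$ and the kernel is at most
$1$; in the integral part $|k|\cdot|k|$ cancels against the kernel mass $1/(r|k|^2)$. Hence the
constant $1+1/r$. -/
theorem yNorm_duhamel_le {r : ℝ} (hr : 0 < r) {g : ℝ → (Fin 3 → ℤ) → ℝ≥0∞}
    (hg : ∀ k, AEMeasurable (fun t => g t k) timeMeasure) :
    yNorm (duhamel r fun t k => efreq k * g t k) ≤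
      (1 + ENNReal.ofReal (1 / r)) * ∑' k, ∫⁻ t, g t k ∂timeMeasure := by
  rw [add_mul, one_mul, ← ENNReal.tsum_mul_left]
  refine add_le_add ?_ ?_
  · refine le_trans (ENNReal.tsum_le_tsum fun k => iSup_le fun t => ?_)
      (ENNReal.tsum_comp_le_tsum_of_injective Subtype.val_injective
        fun k => ∫⁻ t, g t k ∂timeMeasure)
    rw [ENNReal.div_le_iff (efreq_ne_zero k.2) (efreq_ne_top _), mul_comm,
      ← lintegral_const_mul' _ _ (efreq_ne_top _)]
    refine le_trans (setLIntegral_mono' measurableSet_Ioc fun s hs => ?_)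
      (lintegral_mono_set fun s hs => hs.1.le)
    refine mul_le_of_le_one_left' ?_
    rw [ENNReal.ofReal_le_one, Real.exp_le_one_iff, neg_nonpos]
    have := sub_nonneg.2 hs.2
    positivity
  · refine le_trans (ENNReal.tsum_le_tsum fun k => ?_)
      (ENNReal.tsum_comp_le_tsum_of_injective Subtype.val_injective
        fun k => ENNReal.ofReal (1 / r) * ∫⁻ t, g t k ∂timeMeasure)
    rw [lintegral_const_mul' _ _ (efreq_ne_top _)]
    refine le_trans (mul_le_mul_right (lintegral_duhamel_le hr k.2 ((hg k).const_mul _)) _) ?_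
    rw [lintegral_const_mul' _ _ (efreq_ne_top _), ← mul_assoc, ← mul_assoc]
    refine mul_le_mul_left (le_of_eq ?_) _
    have := freq_pos k.2
    rw [efreq, ← ENNReal.ofReal_mul (freq_nonneg _), ← ENNReal.ofReal_mul (by positivity)]
    congr 1
    field_simp

end Estimates

/-! ### Exponential weights absorbed by the heat semigroup. -/

section Weights

open MeasureTheory Filter Topology

/-- The exponential weight `e^{ρ(t)|k|₁}`. -/
noncomputable def expWeight (ρ : ℝ → ℝ) (t : ℝ) (k : Fin 3 → ℤ) : ℝ≥0∞ :=
  ENNReal.ofReal (Real.exp (ρ t * freqOne k))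

/-- The weight `e^{ρ(t)|k|₁}` can be absorbed by the heat semigroup with viscosity `μ`, at the cost
of a factor `e^c` and of lowering the viscosity to `r`. -/
structure IsAbsorbed (μ : ℝ) (ρ : ℝ → ℝ) (c r : ℝ) : Prop where
  rate_pos : 0 < r
  measurable : Measurable ρ
  zero : ρ 0 = 0
  nonneg : ∀ t, 0 ≤ t → 0 ≤ ρ t
  le : ∀ s t, 0 ≤ s → s ≤ t → ∀ k, ρ t * freqOne k - μ * (t - s) * freq k ^ 2 ≤
    ρ s * freqOne k + c - r * (t - s) * freq k ^ 2

/-- The trivial weight makes the unweighted estimates instances of the weighted ones. -/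
theorem isAbsorbed_zero {μ : ℝ} (hμ : 0 < μ) : IsAbsorbed μ (fun _ => 0) 0 μ where
  rate_pos := hμ
  measurable := measurable_const
  zero := rfl
  nonneg _ _ := le_rfl
  le s t _ _ k := by simp

/-- Since $\sqrt t\le\sqrt s+\sqrt{t-s}$, only $\mu\sqrt{t-s}\,|k|_1$ has to be absorbed, and half
of the dissipation does this up to a constant. -/
theorem isAbsorbed_sqrt {μ : ℝ} (hμ : 0 < μ) :
    IsAbsorbed μ (fun t => μ * Real.sqrt t) (3 / 2 * μ) (μ / 2) where
  rate_pos := by positivity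
  measurable := by fun_prop
  zero := by simp
  nonneg _ _ := by positivity
  le s t hs hst k := by
    have h1 : Real.sqrt t ≤ Real.sqrt s + Real.sqrt (t - s) := by
      refine Real.sqrt_le_iff.2 ⟨by positivity, ?_⟩
      nlinarith [Real.sq_sqrt hs, Real.sq_sqrt (sub_nonneg.2 hst),
        mul_nonneg (Real.sqrt_nonneg s) (Real.sqrt_nonneg (t - s))]
    have h2 : Real.sqrt (t - s) * freqOne k ≤ 3 / 2 + (t - s) * freq k ^ 2 / 2 := by
      have h3 := freqOne_sq_le k
      have h4 := Real.sq_sqrt (sub_nonneg.2 hst)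
      have h5 : (t - s) * freqOne k ^ 2 ≤ (t - s) * (3 * freq k ^ 2) :=
        mul_le_mul_of_nonneg_left h3 (sub_nonneg.2 hst)
      have h6 : (Real.sqrt (t - s) * freqOne k) ^ 2 = (t - s) * freqOne k ^ 2 := by
        rw [mul_pow, h4]
      -- With $x=\sqrt{t-s}\,|k|_1$, the square gives $x\le 3/2+x^2/6$, and $x^2\le3(t-s)|k|^2$.
      nlinarith [sq_nonneg (Real.sqrt (t - s) * freqOne k - 3)]
    have h7 := mul_le_mul_of_nonneg_right h1 (freqOne_nonneg k)
    nlinarith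

/-- The growth $\alpha\mu(t-s)|k|_1\le\alpha\mu(t-s)|k|^2$ uses the fraction $\alpha$ of the
dissipation; a positive rate remains because $\alpha<1$. -/
theorem isAbsorbed_linear {μ α : ℝ} (hμ : 0 < μ) (hα : α ∈ Set.Ioo (0 : ℝ) 1) :
    IsAbsorbed μ (fun t => α * μ * t) 0 ((1 - α) * μ) where
  rate_pos := mul_pos (by linarith [hα.2]) hμ
  measurable := by fun_prop
  zero := by simp
  nonneg t ht := mul_nonneg (mul_nonneg hα.1.le hμ.le) ht
  le s t hs hst k := by
    have h := mul_le_mul_of_nonneg_left (freqOne_le_freq_sq k)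
      (mul_nonneg (mul_nonneg hα.1.le hμ.le) (sub_nonneg.2 hst))
    nlinarith

theorem measurable_expWeight {ρ : ℝ → ℝ} (hρ : Measurable ρ) (k : Fin 3 → ℤ) :
    Measurable fun t => expWeight ρ t k := by
  unfold expWeight; fun_prop

theorem expWeight_ne_top (ρ : ℝ → ℝ) (t : ℝ) (k : Fin 3 → ℤ) : expWeight ρ t k ≠ ⊤ :=
  ENNReal.ofReal_ne_top

/-- The triangle inequality for $|k|_1$, exponentiated; this is where $\rho\ge0$ enters. -/
theorem expWeight_add_le {ρ : ℝ → ℝ} {t : ℝ} (hρ : 0 ≤ ρ t) (k l : Fin 3 → ℤ) :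
    expWeight ρ t (k + l) ≤ expWeight ρ t k * expWeight ρ t l := by
  rw [expWeight, expWeight, expWeight, ← ENNReal.ofReal_mul (Real.exp_pos _).le, ← Real.exp_add,
    ← mul_add]
  gcongr
  exact freqOne_add_le k l

namespace IsAbsorbed

variable {μ c r : ℝ} {ρ : ℝ → ℝ}

theorem expWeight_mul_exp_le (h : IsAbsorbed μ ρ c r) {s t : ℝ} (hs : 0 ≤ s) (hst : s ≤ t)
    (k : Fin 3 → ℤ) :
    expWeight ρ t k * ENNReal.ofReal (Real.exp (-(μ * (t - s) * freq k ^ 2))) ≤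
      ENNReal.ofReal (Real.exp c) *
        (ENNReal.ofReal (Real.exp (-(r * (t - s) * freq k ^ 2))) * expWeight ρ s k) := by
  simp only [expWeight, ← ENNReal.ofReal_mul (Real.exp_pos _).le, ← Real.exp_add]
  refine ENNReal.ofReal_le_ofReal (Real.exp_le_exp.2 ?_)
  linarith [h.le s t hs hst k]

theorem expWeight_mul_duhamel_le (h : IsAbsorbed μ ρ c r) (g : ℝ → (Fin 3 → ℤ) → ℝ≥0∞) (t : ℝ)
    (k : Fin 3 → ℤ) :
    expWeight ρ t k * duhamel μ g t k ≤
      ENNReal.ofReal (Real.exp c) * duhamel r (fun s k => expWeight ρ s k * g s k) t k := by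
  rw [duhamel, duhamel, ← lintegral_const_mul' _ _ (expWeight_ne_top _ _ _),
    ← lintegral_const_mul' _ _ ENNReal.ofReal_ne_top]
  refine setLIntegral_mono' measurableSet_Ioc fun s hs => ?_
  have := mul_le_mul_left (h.expWeight_mul_exp_le hs.1.le hs.2 k) (g s k)
  simpa only [mul_assoc] using this

theorem expWeight_mul_freqConv_le (h : IsAbsorbed μ ρ c r) (f g : ℝ → (Fin 3 → ℤ) → ℝ≥0∞) {t : ℝ}
    (ht : 0 ≤ t) (k : Fin 3 → ℤ) :
    expWeight ρ t k * freqConv f g t k ≤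
      freqConv (fun s k => expWeight ρ s k * f s k) (fun s k => expWeight ρ s k * g s k) t k := by
  rw [freqConv, freqConv, ← ENNReal.tsum_mul_left]
  refine ENNReal.tsum_le_tsum fun l => ?_
  have := expWeight_add_le (h.nonneg t ht) l (k - l)
  rw [add_sub_cancel] at this
  calc _ ≤ expWeight ρ t l * expWeight ρ t (k - l) * (f t l * g t (k - l)) := by gcongr
    _ = _ := by ring

/-- The bilinear estimate in the space with weight `e^{ρ(t)|k|₁}`. -/
theorem yNorm_duhamel_freqConv_le (h : IsAbsorbed μ ρ c r) {f g : ℝ → (Fin 3 → ℤ) → ℝ≥0∞}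
    (hf : ∀ k, AEMeasurable (fun t => f t k) timeMeasure)
    (hg : ∀ k, AEMeasurable (fun t => g t k) timeMeasure)
    (hf0 : ∀ t, 0 ≤ t → f t 0 = 0) (hg0 : ∀ t, 0 ≤ t → g t 0 = 0) :
    yNorm (fun t k => expWeight ρ t k * duhamel μ (fun s k => efreq k * freqConv f g s k) t k) ≤
      ENNReal.ofReal (Real.exp c) * (1 + ENNReal.ofReal (1 / r)) *
        (yNorm (fun t k => expWeight ρ t k * f t k) *
          yNorm (fun t k => expWeight ρ t k * g t k)) := by
  set F : ℝ → (Fin 3 → ℤ) → ℝ≥0∞ := fun t k => expWeight ρ t k * f t k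
  set G : ℝ → (Fin 3 → ℤ) → ℝ≥0∞ := fun t k => expWeight ρ t k * g t k
  have hF : ∀ k, AEMeasurable (fun t => F t k) timeMeasure := fun k =>
    (measurable_expWeight h.measurable k).aemeasurable.mul (hf k)
  have hG : ∀ k, AEMeasurable (fun t => G t k) timeMeasure := fun k =>
    (measurable_expWeight h.measurable k).aemeasurable.mul (hg k)
  calc _ ≤ yNorm (fun t k => ENNReal.ofReal (Real.exp c) *
          duhamel r (fun s k => efreq k * freqConv F G s k) t k) := by
        refine yNorm_mono fun t ht k hk => (h.expWeight_mul_duhamel_le _ t k).trans ?_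
        refine mul_le_mul_right (setLIntegral_mono' measurableSet_Ioc fun s hs => ?_) _
        refine mul_le_mul_right ?_ _
        beta_reduce
        rw [mul_left_comm]
        exact mul_le_mul_right (h.expWeight_mul_freqConv_le f g hs.1.le k) _
    _ = ENNReal.ofReal (Real.exp c) *
          yNorm (duhamel r (fun s k => efreq k * freqConv F G s k)) :=
        yNorm_const_mul ENNReal.ofReal_ne_top _
    _ ≤ ENNReal.ofReal (Real.exp c) * ((1 + ENNReal.ofReal (1 / r)) * (yNorm F * yNorm G)) := by
        refine mul_le_mul_right (le_trans
          (yNorm_duhamel_le h.rate_pos (aemeasurable_freqConv hF hG)) ?_) _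
        exact mul_le_mul_right (tsum_lintegral_freqConv_le hF hG
          (fun t ht => by simp [F, hf0 t ht]) (fun t ht => by simp [G, hg0 t ht])) _
    _ = _ := by rw [mul_assoc]

/-- The heat flow is bounded in the space with weight `e^{ρ(t)|k|₁}`. -/
theorem yNorm_heat_le (h : IsAbsorbed μ ρ c r) (x : (Fin 3 → ℤ) → ℝ≥0∞) :
    yNorm (fun t k => expWeight ρ t k *
        (ENNReal.ofReal (Real.exp (-(μ * t * freq k ^ 2))) * x k)) ≤
      ENNReal.ofReal (Real.exp c) * (1 + ENNReal.ofReal (1 / r)) *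
        ∑' k : {k : Fin 3 → ℤ // k ≠ 0}, x k / efreq k := by
  have hr := h.rate_pos
  calc _ ≤ yNorm (fun t k => ENNReal.ofReal (Real.exp c) *
          (ENNReal.ofReal (Real.exp (-(r * t * freq k ^ 2))) * x k)) := by
        refine yNorm_mono fun t ht k hk => ?_
        -- Absorption from time $0$, where the weight is $1$: the data need no decay beyond
        -- $X^{-1}$.
        have := h.expWeight_mul_exp_le le_rfl ht k
        simp only [sub_zero] at this
        have h0 : expWeight ρ 0 k = 1 := by simp [expWeight, h.zero]
        rw [h0, mul_one] at this
        rw [← mul_assoc, ← mul_assoc]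
        gcongr
    _ = ENNReal.ofReal (Real.exp c) * yNorm (fun t k =>
          ENNReal.ofReal (Real.exp (-(r * t * freq k ^ 2))) * x k) :=
        yNorm_const_mul ENNReal.ofReal_ne_top _
    _ ≤ _ := by
        rw [mul_assoc, add_mul, one_mul, ← ENNReal.tsum_mul_left]
        refine mul_le_mul_right (add_le_add (ENNReal.tsum_le_tsum fun k => iSup_le fun t => ?_)
          (ENNReal.tsum_le_tsum fun k => ?_)) _
        · refine ENNReal.div_le_div_right (mul_le_of_le_one_left' ?_) _
          rw [ENNReal.ofReal_le_one, Real.exp_le_one_iff, neg_nonpos]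
          have : (0 : ℝ) ≤ t := t.2
          positivity
        · have hk := freq_pos k.2
          have hb : 0 < r * freq k ^ 2 := by positivity
          have h1 := lintegral_exp_decay hb 0
          simp only [sub_zero] at h1
          rw [lintegral_const_mul' _ _ (efreq_ne_top _), lintegral_mul_const _ (by fun_prop)]
          have h2 : ∀ t, r * t * freq k ^ 2 = r * freq k ^ 2 * t := fun t => by ring
          simp only [h2]
          rw [h1, ENNReal.div_eq_inv_mul, ← mul_assoc, ← mul_assoc]
          refine mul_le_mul_left (le_of_eq ?_) _
          rw [efreq, ← ENNReal.ofReal_inv_of_pos hk, ← ENNReal.ofReal_mul (freq_nonneg _),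
            ← ENNReal.ofReal_mul (by positivity)]
          congr 1
          field_simp

end IsAbsorbed

end Weights

/-! ### The mild formulation as a map on Fourier coefficients. -/

section MildMap

open MeasureTheory Filter Topology

/-- The constant is $1+3$: the identity, and a sum of three terms $k_ik_jw_j/|k|^2$. -/
theorem enorm_leraySymbol_le (k : Fin 3 → ℤ) {w : Fin 3 → ℂ} {W : ℝ≥0∞} (hw : ∀ i, ‖w i‖ₑ ≤ W)
    (i : Fin 3) : ‖leraySymbol k w i‖ₑ ≤ 4 * W := by
  rcases eq_or_ne W ⊤ with rfl | hW
  · simp [ENNReal.mul_top]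
  lift W to ℝ≥0 using hW
  have hw' : ∀ i, ‖w i‖ ≤ W := fun i => by
    have := hw i; rw [enorm_le_coe] at this; exact_mod_cast this
  have hk : ∀ j, ‖(k j : ℂ)‖ ≤ freq k := fun j => by
    rw [Complex.norm_intCast]; exact abs_le_freq k j
  have h1 : ‖∑ j, (k j : ℂ) * w j‖ ≤ 3 * (freq k * W) := by
    refine (norm_sum_le_of_le _ fun j _ => (norm_mul_le _ _).trans
      (mul_le_mul (hk j) (hw' j) (norm_nonneg _) (freq_nonneg k))).trans ?_
    simp
  have h2 : ‖(k i : ℂ) * (∑ j, (k j : ℂ) * w j) / ((freq k ^ 2 : ℝ) : ℂ)‖ ≤ 3 * W := by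
    rw [norm_div, norm_mul, Complex.norm_real, Real.norm_of_nonneg (sq_nonneg _)]
    -- If $|k|=0$ the quotient is $0$ by the convention for division by zero.
    rcases eq_or_lt_of_le (freq_nonneg k) with h0 | h0
    · rw [← h0]; simp
    rw [div_le_iff₀ (by positivity)]
    calc _ ≤ freq k * (3 * (freq k * W)) :=
          mul_le_mul (hk i) h1 (norm_nonneg _) (freq_nonneg k)
      _ = _ := by ring
  have h3 : ‖leraySymbol k w i‖ ≤ (4 * W : ℝ≥0) := by
    refine (norm_sub_le _ _).trans ?_
    have h4 : ((4 * W : ℝ≥0) : ℝ) = 4 * W := by push_cast; ring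
    rw [h4]
    linarith [hw' i]
  have : ‖leraySymbol k w i‖ₑ ≤ ((4 * W : ℝ≥0) : ℝ≥0∞) := enorm_le_coe.2 (by exact_mod_cast h3)
  simpa using this

theorem leraySymbol_sub (k : Fin 3 → ℤ) (w w' : Fin 3 → ℂ) (i : Fin 3) :
    leraySymbol k w i - leraySymbol k w' i = leraySymbol k (fun j => w j - w' j) i := by
  simp only [leraySymbol, mul_sub, Finset.sum_sub_distrib]
  ring

/-- The `k`-th Fourier coefficient of `ℙ div (b ⊗ b)`, in terms of the Fourier coefficients `b`. -/
noncomputable def nonlinCoeff (b : (Fin 3 → ℤ) → EuclideanSpace ℂ (Fin 3)) (k : Fin 3 → ℤ)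
    (i : Fin 3) : ℂ :=
  leraySymbol k (fun i => ∑ j, Complex.I * (k j : ℂ) * ∑' l, b l i * b (k - l) j) i

theorem nonlinCoeff_zero_right (b : (Fin 3 → ℤ) → EuclideanSpace ℂ (Fin 3)) (i : Fin 3) :
    nonlinCoeff b 0 i = 0 := by
  simp [nonlinCoeff, leraySymbol]

theorem enorm_coord_le (x : EuclideanSpace ℂ (Fin 3)) (i : Fin 3) : ‖x i‖ₑ ≤ ‖x‖ₑ :=
  enorm_le_iff_norm_le.2 (PiLp.norm_apply_le x i)

/-- No summability is needed: if the right side is infinite there is nothing to prove. -/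
theorem enorm_tsum_le {ι : Type*} (f : ι → ℂ) : ‖∑' i, f i‖ₑ ≤ ∑' i, ‖f i‖ₑ := by
  by_cases h : ∑' i, ‖f i‖ₑ = ⊤
  · simp [h]
  have hs : Summable fun i => ‖f i‖ := by
    have := ENNReal.summable_toReal h
    simpa using this
  have h1 : ‖∑' i, f i‖ₑ ≤ ENNReal.ofReal (∑' i, ‖f i‖) := by
    rw [← ofReal_norm]
    exact ENNReal.ofReal_le_ofReal (norm_tsum_le_tsum_norm hs)
  rw [ENNReal.ofReal_tsum_of_nonneg (fun _ => norm_nonneg _) hs] at h1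
  simpa using h1

theorem summable_of_tsum_enorm_ne_top {ι : Type*} {f : ι → ℂ} (h : ∑' i, ‖f i‖ₑ ≠ ⊤) :
    Summable f := by
  have := ENNReal.summable_toReal h
  exact Summable.of_norm (by simpa using this)

/-- The difference of two nonlinear terms, bounded by the differences of the coefficients. -/
theorem enorm_nonlinCoeff_sub_le (a b : ℝ → (Fin 3 → ℤ) → EuclideanSpace ℂ (Fin 3)) (s : ℝ)
    (k : Fin 3 → ℤ) (ha : freqConv (fun s k => ‖a s k‖ₑ) (fun s k => ‖a s k‖ₑ) s k ≠ ⊤)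
    (hb : freqConv (fun s k => ‖b s k‖ₑ) (fun s k => ‖b s k‖ₑ) s k ≠ ⊤) (i : Fin 3) :
    ‖nonlinCoeff (a s) k i - nonlinCoeff (b s) k i‖ₑ ≤
      12 * (efreq k * (freqConv (fun s k => ‖a s k - b s k‖ₑ) (fun s k => ‖a s k‖ₑ) s k +
        freqConv (fun s k => ‖b s k‖ₑ) (fun s k => ‖a s k - b s k‖ₑ) s k)) := by
  set S : ℝ≥0∞ := freqConv (fun s k => ‖a s k - b s k‖ₑ) (fun s k => ‖a s k‖ₑ) s k +
        freqConv (fun s k => ‖b s k‖ₑ) (fun s k => ‖a s k - b s k‖ₑ) s k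
  have hsum : ∀ c : ℝ → (Fin 3 → ℤ) → EuclideanSpace ℂ (Fin 3),
      freqConv (fun s k => ‖c s k‖ₑ) (fun s k => ‖c s k‖ₑ) s k ≠ ⊤ → ∀ i j,
      Summable fun l => c s l i * c s (k - l) j := by
    intro c hc i j
    refine summable_of_tsum_enorm_ne_top (ne_top_of_le_ne_top hc (ENNReal.tsum_le_tsum fun l => ?_))
    rw [enorm_mul]
    exact mul_le_mul' (enorm_coord_le _ _) (enorm_coord_le _ _)
  have hD : ∀ i j, ‖(∑' l, a s l i * a s (k - l) j) - ∑' l, b s l i * b s (k - l) j‖ₑ ≤ S := by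
    intro i j
    -- Finiteness of both convolutions is used here: the two series may be subtracted term by term.
    rw [← (hsum a ha i j).tsum_sub (hsum b hb i j)]
    refine (enorm_tsum_le _).trans ?_
    simp only [S, freqConv]
    rw [← ENNReal.tsum_add]
    refine ENNReal.tsum_le_tsum fun l => ?_
    -- The splitting $a\otimes a-b\otimes b=(a-b)\otimes a+b\otimes(a-b)$.
    have : a s l i * a s (k - l) j - b s l i * b s (k - l) j =
        (a s l - b s l) i * a s (k - l) j + b s l i * (a s (k - l) - b s (k - l)) j := by
      simp only [PiLp.sub_apply]; ring
    rw [this]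
    refine (enorm_add_le _ _).trans ?_
    rw [enorm_mul, enorm_mul]
    gcongr <;> exact enorm_coord_le _ _
  rw [nonlinCoeff, nonlinCoeff, leraySymbol_sub]
  -- The $4$ comes from the Leray symbol, the $3$ from the sum over $j$ in the divergence.
  have h12 : (12 : ℝ≥0∞) = 4 * 3 := by norm_num
  rw [h12, mul_assoc]
  refine enorm_leraySymbol_le k (fun i => ?_) i
  rw [← Finset.sum_sub_distrib]
  simp only [← mul_sub]
  calc _ ≤ ∑ j : Fin 3, efreq k * S := by
        refine (enorm_sum_le _ _).trans (Finset.sum_le_sum fun j _ => ?_)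
        rw [enorm_mul]
        refine mul_le_mul' ?_ (hD i j)
        rw [← ofReal_norm, norm_mul, Complex.norm_I, one_mul, Complex.norm_intCast]
        exact ENNReal.ofReal_le_ofReal (abs_le_freq k j)
    _ = _ := by simp

/-- A family of Fourier coefficients of a field in `𝒴`. -/
structure MemYCoeff (a : ℝ → (Fin 3 → ℤ) → EuclideanSpace ℂ (Fin 3)) : Prop where
  aemeasurable : ∀ k, AEMeasurable (fun t => a t k) timeMeasure
  zero : ∀ t, 0 ≤ t → a t 0 = 0
  lt_top : yNorm (fun t k => ‖a t k‖ₑ) < ⊤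

namespace MemYCoeff

variable {a b : ℝ → (Fin 3 → ℤ) → EuclideanSpace ℂ (Fin 3)}

theorem aemeasurable_enorm (ha : MemYCoeff a) (k : Fin 3 → ℤ) :
    AEMeasurable (fun t => ‖a t k‖ₑ) timeMeasure := (ha.aemeasurable k).enorm

theorem aemeasurable_enorm_sub (ha : MemYCoeff a) (hb : MemYCoeff b) (k : Fin 3 → ℤ) :
    AEMeasurable (fun t => ‖a t k - b t k‖ₑ) timeMeasure :=
  ((ha.aemeasurable k).sub (hb.aemeasurable k)).enorm

theorem lintegral_freqConv_lt_top (ha : MemYCoeff a) (k : Fin 3 → ℤ) :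
    ∫⁻ t, freqConv (fun s k => ‖a s k‖ₑ) (fun s k => ‖a s k‖ₑ) t k ∂timeMeasure < ⊤ := by
  refine lt_of_le_of_lt ((ENNReal.le_tsum k).trans (tsum_lintegral_freqConv_le
    ha.aemeasurable_enorm ha.aemeasurable_enorm (fun t ht => by simp [ha.zero t ht])
    (fun t ht => by simp [ha.zero t ht]))) (ENNReal.mul_lt_top ha.lt_top ha.lt_top)

/-- A finite time integral forces absolute convergence of the product series for almost every time.
At the exceptional times a divergent series has a default value, which the Duhamel integral does not
see. -/
theorem ae_freqConv_ne_top (ha : MemYCoeff a) (k : Fin 3 → ℤ) :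
    ∀ᵐ t ∂timeMeasure, freqConv (fun s k => ‖a s k‖ₑ) (fun s k => ‖a s k‖ₑ) t k ≠ ⊤ :=
  (ae_lt_top' (aemeasurable_freqConv ha.aemeasurable_enorm ha.aemeasurable_enorm k)
    (ha.lintegral_freqConv_lt_top k).ne).mono fun _ h => h.ne

theorem zero_memYCoeff : MemYCoeff (fun _ _ => 0) where
  aemeasurable _ := aemeasurable_const
  zero _ _ := rfl
  lt_top := by simp [yNorm, supNorm, intNorm]

theorem aemeasurable_nonlinCoeff (ha : MemYCoeff a) (k : Fin 3 → ℤ) (i : Fin 3) :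
    AEMeasurable (fun s => nonlinCoeff (a s) k i) timeMeasure := by
  have hc : ∀ k i, AEMeasurable (fun s => a s k i) timeMeasure := fun k i =>
    (EuclideanSpace.proj (𝕜 := ℂ) i : EuclideanSpace ℂ (Fin 3) →L[ℂ] ℂ).measurable.comp_aemeasurable
      (ha.aemeasurable k)
  have hd : ∀ i, AEMeasurable (fun s => ∑ j, Complex.I * (k j : ℂ) *
      ∑' l, a s l i * a s (k - l) j) timeMeasure := fun i =>
    Finset.aemeasurable_fun_sum _ fun j _ =>
      (AEMeasurable.tsum fun l => (hc l i).mul (hc (k - l) j)).const_mul _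
  exact (hd i).sub (((Finset.aemeasurable_fun_sum _ fun j _ => (hd j).const_mul _).const_mul
    _).div_const _)

theorem ae_enorm_nonlinCoeff_le (ha : MemYCoeff a) (k : Fin 3 → ℤ) (i : Fin 3) :
    ∀ᵐ s ∂timeMeasure, ‖nonlinCoeff (a s) k i‖ₑ ≤
      12 * (efreq k * freqConv (fun s k => ‖a s k‖ₑ) (fun s k => ‖a s k‖ₑ) s k) := by
  filter_upwards [ha.ae_freqConv_ne_top k] with s hs
  have := enorm_nonlinCoeff_sub_le a (fun _ _ => 0) s k hs (by simp [freqConv]) i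
  simpa [freqConv, nonlinCoeff, leraySymbol] using this

end MemYCoeff

theorem enorm_exp_ofReal (x : ℝ) : ‖(Real.exp x : ℂ)‖ₑ = ENNReal.ofReal (Real.exp x) := by
  rw [← ofReal_norm, Complex.norm_real, Real.norm_of_nonneg (Real.exp_pos x).le]

/-- The integrand of the Duhamel term. -/
noncomputable def duhamelIntegrand (μ : ℝ) (a : ℝ → (Fin 3 → ℤ) → EuclideanSpace ℂ (Fin 3))
    (k : Fin 3 → ℤ) (i : Fin 3) (t s : ℝ) : ℂ :=
  (Real.exp (-(μ * (t - s) * freq k ^ 2)) : ℂ) * nonlinCoeff (a s) k i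

/-- The right-hand side of the mild formulation, with initial coefficients `x`. -/
noncomputable def mildMap (μ : ℝ) (x : (Fin 3 → ℤ) → EuclideanSpace ℂ (Fin 3))
    (a : ℝ → (Fin 3 → ℤ) → EuclideanSpace ℂ (Fin 3)) (t : ℝ) (k : Fin 3 → ℤ) :
    EuclideanSpace ℂ (Fin 3) :=
  WithLp.toLp 2 fun i => (Real.exp (-(μ * t * freq k ^ 2)) : ℂ) * x k i
    - ∫ s in (0 : ℝ)..t, duhamelIntegrand μ a k i t s

theorem mildMap_zero_right (μ : ℝ) (x : (Fin 3 → ℤ) → EuclideanSpace ℂ (Fin 3)) (t : ℝ)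
    (k : Fin 3 → ℤ) :
    mildMap μ x (fun _ _ => 0) t k = (Real.exp (-(μ * t * freq k ^ 2)) : ℂ) • x k := by
  ext i
  simp [mildMap, duhamelIntegrand, nonlinCoeff, leraySymbol]

theorem mildMap_freq_zero (μ : ℝ) {x : (Fin 3 → ℤ) → EuclideanSpace ℂ (Fin 3)} (hx : x 0 = 0)
    (a : ℝ → (Fin 3 → ℤ) → EuclideanSpace ℂ (Fin 3)) (t : ℝ) : mildMap μ x a t 0 = 0 := by
  ext i
  simp [mildMap, duhamelIntegrand, nonlinCoeff_zero_right, hx]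

/-- The variable interval of integration becomes the indicator of $\{0<s\le t\}$ in the plane, and
integration in one variable preserves measurability. -/
theorem aemeasurable_mildMap (μ : ℝ) (x : (Fin 3 → ℤ) → EuclideanSpace ℂ (Fin 3))
    {a : ℝ → (Fin 3 → ℤ) → EuclideanSpace ℂ (Fin 3)} (ha : MemYCoeff a) (k : Fin 3 → ℤ) :
    AEMeasurable (fun t => mildMap μ x a t k) timeMeasure := by
  refine (WithLp.measurable_toLp 2 _).comp_aemeasurable (aemeasurable_pi_lambda _ fun i => ?_)
  refine AEMeasurable.sub (by fun_prop) ?_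
  set F : ℝ × ℝ → ℂ := {p : ℝ × ℝ | 0 < p.2 ∧ p.2 ≤ p.1}.indicator
    fun p => duhamelIntegrand μ a k i p.1 p.2
  have hS : MeasurableSet {p : ℝ × ℝ | 0 < p.2 ∧ p.2 ≤ p.1} :=
    (measurableSet_lt measurable_const measurable_snd).inter
      (measurableSet_le measurable_snd measurable_fst)
  have hF : AEStronglyMeasurable F (timeMeasure.prod timeMeasure) := by
    refine (AEMeasurable.indicator ?_ hS).aestronglyMeasurable
    exact AEMeasurable.mul (by fun_prop) (ha.aemeasurable_nonlinCoeff k i).comp_snd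
  refine hF.integral_prod_right'.aemeasurable.congr ?_
  filter_upwards [ae_restrict_mem measurableSet_Ici] with t ht
  rw [intervalIntegral.integral_of_le ht]
  have : ∀ s, F (t, s) = (Set.Ioc 0 t).indicator (fun s => duhamelIntegrand μ a k i t s) s := by
    intro s; simp [F, Set.indicator_apply]
  simp only [this]
  rw [integral_indicator measurableSet_Ioc, Measure.restrict_restrict measurableSet_Ioc,
    Set.inter_eq_left.2 fun s hs => hs.1.le]

theorem aemeasurable_duhamel (r : ℝ) {g : ℝ → (Fin 3 → ℤ) → ℝ≥0∞} {k : Fin 3 → ℤ}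
    (hg : AEMeasurable (fun t => g t k) timeMeasure) :
    AEMeasurable (fun t => duhamel r g t k) timeMeasure := by
  set f : ℝ × ℝ → ℝ≥0∞ := fun p =>
    ENNReal.ofReal (Real.exp (-(r * (p.1 - p.2) * freq k ^ 2))) * g p.2 k
  set F : ℝ × ℝ → ℝ≥0∞ := {p : ℝ × ℝ | 0 < p.2 ∧ p.2 ≤ p.1}.indicator f
  have hS : MeasurableSet {p : ℝ × ℝ | 0 < p.2 ∧ p.2 ≤ p.1} :=
    (measurableSet_lt measurable_const measurable_snd).inter
      (measurableSet_le measurable_snd measurable_fst)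
  have hF : AEMeasurable F (timeMeasure.prod timeMeasure) :=
    AEMeasurable.indicator (AEMeasurable.mul (by fun_prop) hg.comp_snd) hS
  refine hF.lintegral_prod_right'.congr (.of_forall fun t => ?_)
  have : ∀ s, F (t, s) = (Set.Ioc 0 t).indicator (fun s => f (t, s)) s := by
    intro s; simp [F, Set.indicator_apply]
  simp only [this]
  rw [lintegral_indicator measurableSet_Ioc, Measure.restrict_restrict measurableSet_Ioc,
    Set.inter_eq_left.2 fun s hs => hs.1.le]
  rfl

theorem timeMeasure_Ioc_le (t : ℝ) : volume.restrict (Set.Ioc 0 t) ≤ timeMeasure :=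
  Measure.restrict_mono (fun _ hs => hs.1.le) le_rfl

theorem integrableOn_duhamelIntegrand {μ : ℝ} (hμ : 0 < μ)
    {a : ℝ → (Fin 3 → ℤ) → EuclideanSpace ℂ (Fin 3)} (ha : MemYCoeff a) (k : Fin 3 → ℤ)
    (i : Fin 3) (t : ℝ) : IntegrableOn (duhamelIntegrand μ a k i t) (Set.Ioc 0 t) := by
  refine ⟨(AEMeasurable.mul (by fun_prop) ((ha.aemeasurable_nonlinCoeff k i).mono_measure
    (timeMeasure_Ioc_le t))).aestronglyMeasurable, ?_⟩
  refine lt_of_le_of_lt (b := ∫⁻ s, 12 * (efreq k * freqConv (fun s k => ‖a s k‖ₑ)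
      (fun s k => ‖a s k‖ₑ) s k) ∂timeMeasure) ?_ ?_
  · refine le_trans (lintegral_mono_ae ?_) (lintegral_mono' (timeMeasure_Ioc_le t) le_rfl)
    filter_upwards [ae_mono (timeMeasure_Ioc_le t) (ha.ae_enorm_nonlinCoeff_le k i),
      ae_restrict_mem measurableSet_Ioc] with s hs hst
    rw [duhamelIntegrand, enorm_mul, enorm_exp_ofReal]
    refine (mul_le_of_le_one_left' ?_).trans hs
    rw [ENNReal.ofReal_le_one, Real.exp_le_one_iff, neg_nonpos]
    have := sub_nonneg.2 hst.2
    positivity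
  · rw [lintegral_const_mul' _ _ (by simp), lintegral_const_mul' _ _ (efreq_ne_top k)]
    exact ENNReal.mul_lt_top (by simp) (ENNReal.mul_lt_top (efreq_ne_top k).lt_top
      (ha.lintegral_freqConv_lt_top k))

theorem enorm_le_three_mul {x : EuclideanSpace ℂ (Fin 3)} {M : ℝ≥0∞} (h : ∀ i, ‖x i‖ₑ ≤ M) :
    ‖x‖ₑ ≤ 3 * M := by
  have : x = ∑ i, EuclideanSpace.single i (x i) := by
    ext j; simp [Finset.sum_apply, Pi.single_apply]
  rw [this]
  refine (enorm_sum_le _ _).trans ((Finset.sum_le_sum fun i _ => ?_).trans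
    (by simp : ∑ i : Fin 3, M ≤ 3 * M))
  rw [← ofReal_norm, PiLp.norm_single, ofReal_norm]
  exact h i

theorem enorm_mildMap_sub_le {μ : ℝ} (hμ : 0 < μ) (x : (Fin 3 → ℤ) → EuclideanSpace ℂ (Fin 3))
    {a b : ℝ → (Fin 3 → ℤ) → EuclideanSpace ℂ (Fin 3)} (ha : MemYCoeff a) (hb : MemYCoeff b)
    {t : ℝ} (ht : 0 ≤ t) (k : Fin 3 → ℤ) :
    ‖mildMap μ x a t k - mildMap μ x b t k‖ₑ ≤ 36 *
      (duhamel μ (fun s k => efreq k * freqConv (fun s k => ‖a s k - b s k‖ₑ)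
          (fun s k => ‖a s k‖ₑ) s k) t k +
        duhamel μ (fun s k => efreq k * freqConv (fun s k => ‖b s k‖ₑ)
          (fun s k => ‖a s k - b s k‖ₑ) s k) t k) := by
  -- The $3$ counts the components of the vector, the $12$ comes from the nonlinearity.
  have h36 : (36 : ℝ≥0∞) = 3 * 12 := by norm_num
  rw [h36, mul_assoc]
  refine enorm_le_three_mul fun i => ?_
  have h1 : (mildMap μ x a t k - mildMap μ x b t k) i =
      -∫ s in Set.Ioc 0 t, (duhamelIntegrand μ a k i t s - duhamelIntegrand μ b k i t s) := by
    rw [integral_sub (integrableOn_duhamelIntegrand hμ ha k i t)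
      (integrableOn_duhamelIntegrand hμ hb k i t)]
    simp only [mildMap, PiLp.sub_apply, intervalIntegral.integral_of_le ht]
    ring
  rw [h1, enorm_neg]
  refine (enorm_integral_le_lintegral_enorm _).trans ?_
  have hm : AEMeasurable (fun s => ENNReal.ofReal (Real.exp (-(μ * (t - s) * freq k ^ 2))) *
      (efreq k * freqConv (fun s k => ‖a s k - b s k‖ₑ) (fun s k => ‖a s k‖ₑ) s k))
      (volume.restrict (Set.Ioc 0 t)) :=
    AEMeasurable.mul (by fun_prop) (((aemeasurable_freqConv (ha.aemeasurable_enorm_sub hb)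
      ha.aemeasurable_enorm k).mono_measure (timeMeasure_Ioc_le t)).const_mul _)
  rw [duhamel, duhamel, ← lintegral_add_left' hm, ← lintegral_const_mul' _ _ (by simp)]
  refine lintegral_mono_ae ?_
  filter_upwards [ae_mono (timeMeasure_Ioc_le t) (ha.ae_freqConv_ne_top k),
    ae_mono (timeMeasure_Ioc_le t) (hb.ae_freqConv_ne_top k)] with s hsa hsb
  rw [duhamelIntegrand, duhamelIntegrand, ← mul_sub, enorm_mul, enorm_exp_ofReal, ← mul_add,
    ← mul_add, mul_left_comm]
  exact mul_le_mul_right (enorm_nonlinCoeff_sub_le a b s k hsa hsb i) _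

/-- The constant in the linear estimate. -/
noncomputable def linConst (c r : ℝ) : ℝ≥0∞ :=
  ENNReal.ofReal (Real.exp c) * (1 + ENNReal.ofReal (1 / r))

/-- The `𝒴` norm of the coefficients with the weight `e^{ρ(t)|k|₁}`. -/
noncomputable def wNorm (ρ : ℝ → ℝ) (a : ℝ → (Fin 3 → ℤ) → EuclideanSpace ℂ (Fin 3)) : ℝ≥0∞ :=
  yNorm fun t k => expWeight ρ t k * ‖a t k‖ₑ

theorem wNorm_zero_weight (a : ℝ → (Fin 3 → ℤ) → EuclideanSpace ℂ (Fin 3)) :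
    wNorm (fun _ => 0) a = yNorm fun t k => ‖a t k‖ₑ := by
  simp [wNorm, expWeight]

/-- The heat flow of the data cancels, leaving two Duhamel terms for the bilinear estimate. Only the
unweighted norms are assumed finite; the weighted ones may be infinite here. -/
theorem wNorm_mildMap_sub_le {μ c r : ℝ} {ρ : ℝ → ℝ} (hμ : 0 < μ) (h : IsAbsorbed μ ρ c r)
    (x : (Fin 3 → ℤ) → EuclideanSpace ℂ (Fin 3))
    {a b : ℝ → (Fin 3 → ℤ) → EuclideanSpace ℂ (Fin 3)} (ha : MemYCoeff a) (hb : MemYCoeff b) :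
    wNorm ρ (fun t k => mildMap μ x a t k - mildMap μ x b t k) ≤
      36 * linConst c r * ((wNorm ρ a + wNorm ρ b) * wNorm ρ (fun t k => a t k - b t k)) := by
  set D₁ := duhamel μ (fun s k => efreq k * freqConv (fun s k => ‖a s k - b s k‖ₑ)
          (fun s k => ‖a s k‖ₑ) s k)
  set D₂ := duhamel μ (fun s k => efreq k * freqConv (fun s k => ‖b s k‖ₑ)
          (fun s k => ‖a s k - b s k‖ₑ) s k)
  have hD₁ : ∀ k, AEMeasurable (fun t => D₁ t k) timeMeasure := fun k =>
    aemeasurable_duhamel μ ((aemeasurable_freqConv (ha.aemeasurable_enorm_sub hb)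
      ha.aemeasurable_enorm k).const_mul _)
  calc _ ≤ yNorm (fun t k => 36 * (expWeight ρ t k * D₁ t k + expWeight ρ t k * D₂ t k)) := by
        refine yNorm_mono fun t ht k _ => ?_
        rw [← mul_add, mul_left_comm]
        exact mul_le_mul_right (enorm_mildMap_sub_le hμ x ha hb ht k) _
    _ = 36 * yNorm (fun t k => expWeight ρ t k * D₁ t k + expWeight ρ t k * D₂ t k) :=
        yNorm_const_mul (by simp) _
    _ ≤ 36 * (linConst c r * (wNorm ρ (fun t k => a t k - b t k) * wNorm ρ a) +
          linConst c r * (wNorm ρ b * wNorm ρ (fun t k => a t k - b t k))) := by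
        refine mul_le_mul_right ((yNorm_add_le _ fun k =>
          (measurable_expWeight h.measurable k).aemeasurable.mul (hD₁ k)).trans (add_le_add ?_ ?_)) _
        · exact h.yNorm_duhamel_freqConv_le (ha.aemeasurable_enorm_sub hb) ha.aemeasurable_enorm
            (fun t ht => by simp [ha.zero t ht, hb.zero t ht]) (fun t ht => by simp [ha.zero t ht])
        · exact h.yNorm_duhamel_freqConv_le hb.aemeasurable_enorm (ha.aemeasurable_enorm_sub hb)
            (fun t ht => by simp [hb.zero t ht]) (fun t ht => by simp [ha.zero t ht, hb.zero t ht])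
    _ = _ := by ring

end MildMap

/-! ### Picard iteration: existence and uniqueness for coefficients. -/

section Picard

open MeasureTheory Filter Topology

/-- The `X⁻¹` norm in terms of Fourier coefficients. -/
noncomputable def xNorm (x : (Fin 3 → ℤ) → EuclideanSpace ℂ (Fin 3)) : ℝ≥0∞ :=
  ∑' k : {k : Fin 3 → ℤ // k ≠ 0}, ‖x k‖ₑ / efreq k

theorem linConst_lt_top (c r : ℝ) : linConst c r < ⊤ :=
  ENNReal.mul_lt_top ENNReal.ofReal_lt_top (by simp)

theorem linConst_ne_zero (c r : ℝ) : linConst c r ≠ 0 :=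
  mul_ne_zero (by simpa using Real.exp_pos c) (by simp)

theorem wNorm_heat_le {μ c r : ℝ} {ρ : ℝ → ℝ} (h : IsAbsorbed μ ρ c r)
    (x : (Fin 3 → ℤ) → EuclideanSpace ℂ (Fin 3)) :
    wNorm ρ (mildMap μ x fun _ _ => 0) ≤ linConst c r * xNorm x := by
  refine le_trans (le_of_eq ?_) (h.yNorm_heat_le fun k => ‖x k‖ₑ)
  simp only [wNorm, mildMap_zero_right, enorm_smul, enorm_exp_ofReal]

/-- Compare with the zero field, whose image is the heat flow of the data. -/
theorem wNorm_mildMap_le {μ c r : ℝ} {ρ : ℝ → ℝ} (hμ : 0 < μ) (h : IsAbsorbed μ ρ c r)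
    (x : (Fin 3 → ℤ) → EuclideanSpace ℂ (Fin 3))
    {a : ℝ → (Fin 3 → ℤ) → EuclideanSpace ℂ (Fin 3)} (ha : MemYCoeff a) :
    wNorm ρ (mildMap μ x a) ≤ linConst c r * xNorm x + 36 * linConst c r * (wNorm ρ a) ^ 2 := by
  have h0 := MemYCoeff.zero_memYCoeff
  have h1 := wNorm_mildMap_sub_le hμ h x ha h0
  have h2 : wNorm ρ (fun _ _ => 0) = 0 := by simp [wNorm, yNorm, supNorm, intNorm]
  simp only [h2, add_zero, sub_zero] at h1
  rw [sq]
  refine le_trans ?_ (add_le_add (wNorm_heat_le h x) h1)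
  refine le_trans (yNorm_mono fun t ht k _ => ?_) (yNorm_add_le _ fun k =>
    (measurable_expWeight h.measurable k).aemeasurable.mul (aemeasurable_mildMap μ x h0 k).enorm)
  rw [← mul_add]
  refine mul_le_mul_right (le_trans (le_of_eq ?_) (enorm_add_le _ _)) _
  rw [add_sub_cancel]

theorem MemYCoeff.mildMap {μ : ℝ} (hμ : 0 < μ) {x : (Fin 3 → ℤ) → EuclideanSpace ℂ (Fin 3)}
    (hx0 : x 0 = 0) (hx : xNorm x < ⊤)
    {a : ℝ → (Fin 3 → ℤ) → EuclideanSpace ℂ (Fin 3)} (ha : MemYCoeff a) :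
    MemYCoeff (mildMap μ x a) where
  aemeasurable := aemeasurable_mildMap μ x ha
  zero t _ := mildMap_freq_zero μ hx0 a t
  lt_top := by
    have := wNorm_mildMap_le hμ (isAbsorbed_zero hμ) x ha
    rw [wNorm_zero_weight, wNorm_zero_weight] at this
    refine this.trans_lt (ENNReal.add_lt_top.2 ⟨ENNReal.mul_lt_top (linConst_lt_top _ _) hx, ?_⟩)
    exact ENNReal.mul_lt_top (ENNReal.mul_lt_top (by simp) (linConst_lt_top _ _))
      (ENNReal.pow_lt_top ha.lt_top)

/-- The Picard iterates of the mild formulation. -/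
noncomputable def picard (μ : ℝ) (x : (Fin 3 → ℤ) → EuclideanSpace ℂ (Fin 3)) :
    ℕ → ℝ → (Fin 3 → ℤ) → EuclideanSpace ℂ (Fin 3)
  | 0 => fun _ _ => 0
  | n + 1 => mildMap μ x (picard μ x n)

theorem memYCoeff_picard {μ : ℝ} (hμ : 0 < μ) {x : (Fin 3 → ℤ) → EuclideanSpace ℂ (Fin 3)}
    (hx0 : x 0 = 0) (hx : xNorm x < ⊤) : ∀ n, MemYCoeff (picard μ x n)
  | 0 => MemYCoeff.zero_memYCoeff
  | n + 1 => (memYCoeff_picard hμ hx0 hx n).mildMap hμ hx0 hx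

/-- With $A$ the linear constant and $X$ the norm of the data, the ball of radius $2AX$ is
invariant, since $36A(2AX)^2=144A^2X\cdot AX\le AX$. -/
theorem wNorm_picard_le {μ c r : ℝ} {ρ : ℝ → ℝ} (hμ : 0 < μ) (h : IsAbsorbed μ ρ c r)
    {x : (Fin 3 → ℤ) → EuclideanSpace ℂ (Fin 3)} (hx0 : x 0 = 0)
    (hsmall : 144 * linConst c r ^ 2 * xNorm x ≤ 1) (hx : xNorm x < ⊤) :
    ∀ n, wNorm ρ (picard μ x n) ≤ 2 * (linConst c r * xNorm x)
  | 0 => by simp [picard, wNorm, yNorm, supNorm, intNorm]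
  | n + 1 => by
    refine (wNorm_mildMap_le hμ h x (memYCoeff_picard hμ hx0 hx n)).trans ?_
    have ih := wNorm_picard_le hμ h hx0 hsmall hx n
    calc _ ≤ linConst c r * xNorm x + 36 * linConst c r * (2 * (linConst c r * xNorm x)) ^ 2 := by
          gcongr
      _ = linConst c r * xNorm x +
          144 * linConst c r ^ 2 * xNorm x * (linConst c r * xNorm x) := by ring
      _ ≤ linConst c r * xNorm x + 1 * (linConst c r * xNorm x) := by gcongr
      _ = _ := by ring

/-- On the ball of radius $M$ the Lipschitz constant is $36A(M+M)=72AM\le1/2$. -/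
theorem yNorm_mildMap_sub_le {μ : ℝ} (hμ : 0 < μ) (x : (Fin 3 → ℤ) → EuclideanSpace ℂ (Fin 3))
    {a b : ℝ → (Fin 3 → ℤ) → EuclideanSpace ℂ (Fin 3)} (ha : MemYCoeff a) (hb : MemYCoeff b)
    {M : ℝ≥0∞} (haM : yNorm (fun t k => ‖a t k‖ₑ) ≤ M) (hbM : yNorm (fun t k => ‖b t k‖ₑ) ≤ M)
    (hM : 144 * linConst 0 μ * M ≤ 1) :
    yNorm (fun t k => ‖mildMap μ x a t k - mildMap μ x b t k‖ₑ) ≤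
      2⁻¹ * yNorm (fun t k => ‖a t k - b t k‖ₑ) := by
  have h := wNorm_mildMap_sub_le hμ (isAbsorbed_zero hμ) x ha hb
  simp only [wNorm_zero_weight] at h
  refine h.trans ?_
  rw [← mul_assoc]
  refine mul_le_mul_left ?_ _
  rw [ENNReal.le_inv_iff_mul_le]
  calc _ ≤ 36 * linConst 0 μ * (M + M) * 2 := by gcongr
    _ = 144 * linConst 0 μ * M := by ring
    _ ≤ 1 := hM

/-- Small mild solutions are determined by the initial data. -/
theorem eq_of_mildMap_fixed {μ : ℝ} (hμ : 0 < μ) (x : (Fin 3 → ℤ) → EuclideanSpace ℂ (Fin 3))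
    {a b : ℝ → (Fin 3 → ℤ) → EuclideanSpace ℂ (Fin 3)} (ha : MemYCoeff a) (hb : MemYCoeff b)
    {M : ℝ≥0∞} (haM : yNorm (fun t k => ‖a t k‖ₑ) ≤ M) (hbM : yNorm (fun t k => ‖b t k‖ₑ) ≤ M)
    (hM : 144 * linConst 0 μ * M ≤ 1)
    (hafix : ∀ t, 0 ≤ t → ∀ k, a t k = mildMap μ x a t k)
    (hbfix : ∀ t, 0 ≤ t → ∀ k, b t k = mildMap μ x b t k)
    {t : ℝ} (ht : 0 ≤ t) (k : Fin 3 → ℤ) : a t k = b t k := by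
  set Y := yNorm (fun t k => ‖a t k - b t k‖ₑ) with hY
  have h1 : Y ≤ 2⁻¹ * Y := by
    refine le_trans (yNorm_mono fun t ht k _ => ?_) (yNorm_mildMap_sub_le hμ x ha hb haM hbM hM)
    rw [← hafix t ht k, ← hbfix t ht k]
  -- The inequality $Y\le Y/2$ forces $Y=0$ only if $Y$ is finite.
  have hfin : Y ≠ ⊤ := by
    refine ne_top_of_le_ne_top (ENNReal.add_lt_top.2 ⟨ha.lt_top, hb.lt_top⟩).ne
      (le_trans (yNorm_mono fun t _ k _ => ?_) (yNorm_add_le _ ha.aemeasurable_enorm))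
    exact enorm_sub_le
  have h0 : Y = 0 := by
    by_contra hne
    rw [mul_comm, ← div_eq_mul_inv] at h1
    exact absurd (ENNReal.half_lt_self hne hfin) (not_lt.2 h1)
  rcases eq_or_ne k 0 with rfl | hk
  · rw [ha.zero t ht, hb.zero t ht]
  · have := le_efreq_mul_yNorm (fun t k => ‖a t k - b t k‖ₑ) ht hk
    rw [← hY, h0, mul_zero, nonpos_iff_eq_zero, enorm_eq_zero, sub_eq_zero] at this
    exact this

/-- Convergence comes from the contraction in the unweighted norm alone; every absorbed weight then
gives a bound for the same limit. Hence the quantification over weights after the fixed point. The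
factor $288$ makes the radius $M=2AX$ satisfy $144AM\le1$. -/
theorem exists_mildMap_fixed {μ : ℝ} (hμ : 0 < μ) {x : (Fin 3 → ℤ) → EuclideanSpace ℂ (Fin 3)}
    (hx0 : x 0 = 0) (hx : xNorm x < ⊤) (hsmall : 288 * linConst 0 μ ^ 2 * xNorm x ≤ 1) :
    ∃ a, MemYCoeff a ∧ (∀ t, 0 ≤ t → ∀ k, a t k = mildMap μ x a t k) ∧
      ∀ ρ c r, IsAbsorbed μ ρ c r → 144 * linConst c r ^ 2 * xNorm x ≤ 1 →
        wNorm ρ a ≤ 2 * (linConst c r * xNorm x) := by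
  set M := 2 * (linConst 0 μ * xNorm x) with hMdef
  have hMtop : M ≠ ⊤ :=
    (ENNReal.mul_lt_top (by simp) (ENNReal.mul_lt_top (linConst_lt_top _ _) hx)).ne
  have hM : 144 * linConst 0 μ * M ≤ 1 := by
    refine le_trans (le_of_eq ?_) hsmall; rw [hMdef]; ring
  have hV := memYCoeff_picard hμ hx0 hx
  have hsmall' : 144 * linConst 0 μ ^ 2 * xNorm x ≤ 1 := by
    refine le_trans ?_ hsmall
    gcongr
    norm_num
  have hVM : ∀ n, yNorm (fun t k => ‖picard μ x n t k‖ₑ) ≤ M := fun n => by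
    have := wNorm_picard_le hμ (isAbsorbed_zero hμ) hx0 hsmall' hx n
    rwa [wNorm_zero_weight] at this
  have hcontr : ∀ n p, yNorm (fun t k => ‖picard μ x (n + p) t k - picard μ x n t k‖ₑ) ≤
      M * 2⁻¹ ^ n := by
    intro n
    induction n with
    | zero => intro p; simpa [picard] using hVM p
    | succ n ih =>
      intro p
      rw [add_right_comm]
      refine (yNorm_mildMap_sub_le hμ x (hV _) (hV _) (hVM _) (hVM _) hM).trans ?_
      calc _ ≤ 2⁻¹ * (M * 2⁻¹ ^ n) := mul_le_mul_right (ih p) _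
        _ = _ := by ring
  have hlim : ∀ t, 0 ≤ t → ∀ k, ∃ y, Tendsto (fun n => picard μ x n t k) atTop (𝓝 y) := by
    intro t ht k
    rcases eq_or_ne k 0 with rfl | hk
    · exact ⟨0, by simp [(hV _).zero t ht]⟩
    refine cauchySeq_tendsto_of_complete (cauchySeq_of_edist_le_geometric 2⁻¹ (efreq k * M)
      (by simp) (ENNReal.mul_ne_top (efreq_ne_top k) hMtop) fun n => ?_)
    rw [edist_comm, edist_eq_enorm_sub, mul_assoc]
    exact (le_efreq_mul_yNorm (fun t k => ‖picard μ x (n + 1) t k - picard μ x n t k‖ₑ) ht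
      hk).trans (mul_le_mul_right (hcontr n 1) _)
  -- At negative times the limit is an arbitrary value, which no norm sees.
  choose! a hatend using hlim
  have hw : ∀ ρ c r, IsAbsorbed μ ρ c r → 144 * linConst c r ^ 2 * xNorm x ≤ 1 →
        wNorm ρ a ≤ 2 * (linConst c r * xNorm x) := by
    intro ρ c r h hs
    refine yNorm_le_of_tendsto (g := fun n t k => expWeight ρ t k * ‖picard μ x n t k‖ₑ)
      (fun n k => (measurable_expWeight h.measurable k).aemeasurable.mul
        ((hV n).aemeasurable_enorm k)) (fun t ht k => ?_)
      (.of_forall fun n => wNorm_picard_le hμ h hx0 hs hx n)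
    exact ENNReal.Tendsto.const_mul (hatend t ht k).enorm (.inr (expWeight_ne_top _ _ _))
  have haM : yNorm (fun t k => ‖a t k‖ₑ) ≤ M := by
    have := hw _ _ _ (isAbsorbed_zero hμ) hsmall'
    rwa [wNorm_zero_weight] at this
  have ha : MemYCoeff a :=
    { aemeasurable := fun k => aemeasurable_of_tendsto_metrizable_ae atTop
        (fun n => (hV n).aemeasurable k)
        ((ae_restrict_mem measurableSet_Ici).mono fun t ht => hatend t ht k)
      zero := fun t ht => tendsto_nhds_unique (hatend t ht 0) (by simp [(hV _).zero t ht])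
      lt_top := haM.trans_lt hMtop.lt_top }
  refine ⟨a, ha, fun t ht k => ?_, hw⟩
  rcases eq_or_ne k 0 with rfl | hk
  · rw [ha.zero t ht, mildMap_freq_zero μ hx0]
  -- Fatou's lemma as $p\to\infty$ in `hcontr`.
  have hdiff : ∀ n, yNorm (fun t k => ‖a t k - picard μ x n t k‖ₑ) ≤ M * 2⁻¹ ^ n := by
    intro n
    refine yNorm_le_of_tendsto (g := fun p t k => ‖picard μ x (n + p) t k - picard μ x n t k‖ₑ)
      (fun p k => (hV _).aemeasurable_enorm_sub (hV n) k) (fun t ht k => ?_)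
      (.of_forall fun p => hcontr n p)
    have h1 : Tendsto (fun p => picard μ x (n + p) t k) atTop (𝓝 (a t k)) := by
      simpa only [add_comm n] using (tendsto_add_atTop_iff_nat n).2 (hatend t ht k)
    exact (h1.sub_const _).enorm
  have hle : ∀ n, edist (picard μ x (n + 1) t k) (mildMap μ x a t k) ≤
      efreq k * (2⁻¹ * (M * 2⁻¹ ^ n)) := by
    intro n
    rw [edist_comm, edist_eq_enorm_sub]
    refine (le_efreq_mul_yNorm (fun t k => ‖mildMap μ x a t k - picard μ x (n + 1) t k‖ₑ) ht
      hk).trans (mul_le_mul_right ?_ _)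
    exact (yNorm_mildMap_sub_le hμ x ha (hV n) haM (hVM n) hM).trans
      (mul_le_mul_right (hdiff n) _)
  refine tendsto_nhds_unique ((tendsto_add_atTop_iff_nat 1).2 (hatend t ht k)) ?_
  rw [tendsto_iff_edist_tendsto_0]
  refine tendsto_of_tendsto_of_tendsto_of_le_of_le tendsto_const_nhds ?_ (fun _ => zero_le) hle
  have h2 : Tendsto (fun n : ℕ => (2⁻¹ : ℝ≥0∞) ^ n) atTop (𝓝 0) :=
    ENNReal.tendsto_pow_atTop_nhds_zero_of_lt_one (by simp)
  have h3 := ENNReal.Tendsto.const_mul (ENNReal.Tendsto.const_mul (ENNReal.Tendsto.const_mul h2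
    (.inr hMtop)) (.inr (by simp : (2⁻¹ : ℝ≥0∞) ≠ ⊤))) (.inr (efreq_ne_top k))
  simpa using h3

end Picard

/-! ### Fourier series of test functions. -/

section TorusFourier

open MeasureTheory Filter Topology

/-- The fundamental box `[0, 2π]³`. -/
def torusBox : Set (Fin 3 → ℝ) := Set.Icc 0 fun _ => 2 * Real.pi

theorem isCompact_torusBox : IsCompact torusBox := isCompact_Icc

theorem volume_torusBox : volume.real torusBox = (2 * Real.pi) ^ 3 := by
  have h : ∀ i, (0 : Fin 3 → ℝ) i ≤ (fun _ => 2 * Real.pi) i := fun i => by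
    simpa using Real.pi_pos.le
  rw [Measure.real, torusBox, Real.volume_Icc_pi_toReal h]
  simp

theorem mul_mem_torusTest {φ ψ : (Fin 3 → ℝ) → ℂ} (hφ : φ ∈ torusTest) (hψ : ψ ∈ torusTest) :
    (fun x => φ x * ψ x) ∈ torusTest :=
  ⟨hφ.1.mul hψ.1, fun x j => by simp only [hφ.2 x j, hψ.2 x j]⟩

theorem one_mem_torusTest : (fun _ => 1) ∈ torusTest := ⟨contDiff_const, fun _ _ => rfl⟩

theorem integrableOn_torusBox {φ : (Fin 3 → ℝ) → ℂ} (hφ : Continuous φ) :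
    IntegrableOn φ torusBox := hφ.continuousOn.integrableOn_compact isCompact_torusBox

/-- The partial derivative in the direction of the `j`-th coordinate. -/
noncomputable def partialDeriv (j : Fin 3) (φ : (Fin 3 → ℝ) → ℂ) (x : Fin 3 → ℝ) : ℂ :=
  fderiv ℝ φ x (Pi.single j 1)

theorem partialDeriv_mem_torusTest {φ : (Fin 3 → ℝ) → ℂ} (hφ : φ ∈ torusTest) (j : Fin 3) :
    partialDeriv j φ ∈ torusTest := by
  refine ⟨(hφ.1.fderiv_right (m := ∞) (by simp)).clm_apply contDiff_const, fun x i => ?_⟩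
  have h : (fun y => φ (y + Pi.single i (2 * Real.pi))) = φ := funext fun y => hφ.2 y i
  rw [partialDeriv, ← fderiv_comp_add_right, h, partialDeriv]

/-- The divergence theorem on the box for the field with $j$-th component $\varphi$ and the others
zero; opposite faces cancel by periodicity. -/
theorem integral_partialDeriv {φ : (Fin 3 → ℝ) → ℂ} (hφ : φ ∈ torusTest) (j : Fin 3) :
    ∫ x in torusBox, partialDeriv j φ x = 0 := by
  have hdiff : ∀ x, HasFDerivAt φ (fderiv ℝ φ x) x := fun x =>
    (hφ.1.differentiable (by simp) x).hasFDerivAt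
  have hsum : ∀ x, ∑ i, (if i = j then fderiv ℝ φ x else 0) (Pi.single i 1) =
      partialDeriv j φ x := by
    intro x
    rw [Finset.sum_eq_single j (fun i _ hi => by simp [hi]) (by simp)]
    simp [partialDeriv]
  have key := integral_divergence_of_hasFDerivAt_off_countable' (n := 2) (E := ℂ)
    (0 : Fin 3 → ℝ) (fun _ => 2 * Real.pi) (fun i => by simpa using Real.pi_pos.le)
    (fun i x => if i = j then φ x else 0) (fun i x => if i = j then fderiv ℝ φ x else 0) ∅
    Set.countable_empty
    (fun i => by
      by_cases h : i = j
      · simpa [h] using hφ.1.continuous.continuousOn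
      · simpa [h] using continuousOn_const)
    (fun x _ i => by
      by_cases h : i = j
      · simpa [h] using hdiff x
      · simpa [h] using hasFDerivAt_const (0 : ℂ) x)
    (by
      simp only [hsum]
      exact integrableOn_torusBox (partialDeriv_mem_torusTest hφ j).1.continuous)
  simp only [hsum] at key
  rw [torusBox, key]
  refine Finset.sum_eq_zero fun i _ => ?_
  rw [sub_eq_zero]
  refine integral_congr_ae (.of_forall fun x => ?_)
  by_cases h : i = j
  · subst h
    simp only [if_true]
    have e : i.insertNth (α := fun _ => ℝ) (2 * Real.pi) x =
        i.insertNth (α := fun _ => ℝ) ((0 : Fin 3 → ℝ) i) x + Pi.single i (2 * Real.pi) := by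
      ext l
      refine Fin.succAboveCases i ?_ (fun m => ?_) l
      · simp
      · simp [Fin.succAbove_ne]
    rw [e]
    exact hφ.2 _ i
  · simp [h]

/-- The linear form `x ↦ k·x`. -/
noncomputable def latticeForm (k : Fin 3 → ℤ) : (Fin 3 → ℝ) →L[ℝ] ℝ :=
  ∑ j, (k j : ℝ) • ContinuousLinearMap.proj j

theorem latticeForm_apply (k : Fin 3 → ℤ) (x : Fin 3 → ℝ) :
    latticeForm k x = ∑ j, (k j : ℝ) * x j := by
  simp [latticeForm]

theorem norm_latticeForm_le (k : Fin 3 → ℤ) : ‖latticeForm k‖ ≤ freqOne k := by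
  refine ContinuousLinearMap.opNorm_le_bound _ (freqOne_nonneg k) fun x => ?_
  rw [latticeForm_apply, freqOne, Finset.sum_mul]
  refine norm_sum_le_of_le _ fun j _ => ?_
  rw [norm_mul, Real.norm_eq_abs]
  exact mul_le_mul_of_nonneg_left (norm_le_pi_norm x j) (abs_nonneg _)

theorem torusChar_eq_comp (k : Fin 3 → ℤ) :
    torusChar k = (fun t : ℝ => Complex.exp (Complex.I * t)) ∘ latticeForm k := by
  funext x
  simp [torusChar, latticeForm_apply]

theorem norm_torusChar (k : Fin 3 → ℤ) (x : Fin 3 → ℝ) : ‖torusChar k x‖ = 1 := by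
  rw [torusChar, mul_comm, Complex.norm_exp_ofReal_mul_I]

theorem continuous_torusChar (k : Fin 3 → ℤ) : Continuous (torusChar k) :=
  (torusChar_mem k).1.continuous

theorem torusChar_mul (k l : Fin 3 → ℤ) (x : Fin 3 → ℝ) :
    torusChar k x * torusChar l x = torusChar (k + l) x := by
  rw [torusChar, torusChar, torusChar, ← Complex.exp_add, ← mul_add, ← Complex.ofReal_add,
    ← Finset.sum_add_distrib]
  simp [add_mul]

theorem hasDerivAt_exp_I_mul (t : ℝ) :
    HasDerivAt (fun t : ℝ => Complex.exp (Complex.I * t))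
      (Complex.I * Complex.exp (Complex.I * t)) t := by
  have h : HasDerivAt (fun t : ℝ => Complex.I * (t : ℂ)) Complex.I t := by
    simpa using (Complex.ofRealCLM.hasDerivAt (x := t)).const_mul Complex.I
  simpa [mul_comm] using h.cexp

theorem iteratedDeriv_exp_I_mul (n : ℕ) :
    iteratedDeriv n (fun t : ℝ => Complex.exp (Complex.I * t)) =
      fun t : ℝ => Complex.I ^ n * Complex.exp (Complex.I * t) := by
  induction n with
  | zero => simp
  | succ n ih =>
    rw [iteratedDeriv_succ, ih]
    funext t
    rw [((hasDerivAt_exp_I_mul t).const_mul _).deriv]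
    ring

theorem norm_iteratedFDeriv_torusChar_le (k : Fin 3 → ℤ) (n : ℕ) (x : Fin 3 → ℝ) :
    ‖iteratedFDeriv ℝ n (torusChar k) x‖ ≤ freqOne k ^ n := by
  have hc : ContDiff ℝ n fun t : ℝ => Complex.exp (Complex.I * t) :=
    Complex.contDiff_exp.comp (contDiff_const.mul Complex.ofRealCLM.contDiff)
  rw [torusChar_eq_comp, (latticeForm k).iteratedFDeriv_comp_right hc x le_rfl]
  refine (ContinuousMultilinearMap.norm_compContinuousLinearMap_le _ _).trans ?_
  rw [norm_iteratedFDeriv_eq_norm_iteratedDeriv, iteratedDeriv_exp_I_mul, norm_mul, norm_pow,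
    Complex.norm_I, one_pow, one_mul, mul_comm Complex.I, Complex.norm_exp_ofReal_mul_I, one_mul,
    Finset.prod_const, Finset.card_univ, Fintype.card_fin]
  exact pow_le_pow_left₀ (norm_nonneg _) (norm_latticeForm_le k) n

theorem partialDeriv_torusChar (k : Fin 3 → ℤ) (j : Fin 3) (x : Fin 3 → ℝ) :
    partialDeriv j (torusChar k) x = Complex.I * k j * torusChar k x := by
  have h := (hasDerivAt_exp_I_mul (latticeForm k x)).hasFDerivAt.comp x
    (latticeForm k).hasFDerivAt
  rw [← torusChar_eq_comp] at h
  rw [partialDeriv, h.fderiv, torusChar_eq_comp]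
  simp [latticeForm_apply, Pi.single_apply]
  ring

/-- The pairing `∫ e^{ik·x} φ(x) dx` over the torus. -/
noncomputable def torusPairing (k : Fin 3 → ℤ) (φ : (Fin 3 → ℝ) → ℂ) : ℂ :=
  ∫ x in torusBox, torusChar k x * φ x

theorem norm_torusPairing_le (k : Fin 3 → ℤ) (φ : (Fin 3 → ℝ) → ℂ) :
    ‖torusPairing k φ‖ ≤ ∫ x in torusBox, ‖φ x‖ := by
  refine (norm_integral_le_integral_norm _).trans (le_of_eq ?_)
  simp [norm_torusChar]

theorem torusPairing_add (k : Fin 3 → ℤ) {φ ψ : (Fin 3 → ℝ) → ℂ} (hφ : Continuous φ)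
    (hψ : Continuous ψ) :
    torusPairing k (fun x => φ x + ψ x) = torusPairing k φ + torusPairing k ψ := by
  simp only [torusPairing, mul_add]
  exact integral_add (integrableOn_torusBox ((continuous_torusChar k).mul hφ))
    (integrableOn_torusBox ((continuous_torusChar k).mul hψ))

theorem torusPairing_const_mul (k : Fin 3 → ℤ) (c : ℂ) (φ : (Fin 3 → ℝ) → ℂ) :
    torusPairing k (fun x => c * φ x) = c * torusPairing k φ := by
  simp only [torusPairing, mul_left_comm _ c]
  exact integral_const_mul _ _

theorem torusPairing_partialDeriv (k : Fin 3 → ℤ) {φ : (Fin 3 → ℝ) → ℂ} (hφ : φ ∈ torusTest)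
    (j : Fin 3) : torusPairing k (partialDeriv j φ) = -(Complex.I * k j) * torusPairing k φ := by
  have h1 := integral_partialDeriv (mul_mem_torusTest (torusChar_mem k) hφ) j
  have h2 : ∀ x, partialDeriv j (fun x => torusChar k x * φ x) x =
      torusChar k x * partialDeriv j φ x + Complex.I * k j * (torusChar k x * φ x) := by
    intro x
    have hd : ∀ {ψ : (Fin 3 → ℝ) → ℂ}, ψ ∈ torusTest → DifferentiableAt ℝ ψ x := fun hψ =>
      hψ.1.differentiable (by simp) x
    have h3 := partialDeriv_torusChar k j x
    rw [partialDeriv] at h3 ⊢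
    rw [fderiv_fun_mul (hd (torusChar_mem k)) (hd hφ)]
    simp only [add_apply, smul_apply, smul_eq_mul, h3,
      partialDeriv]
    ring
  have hc1 : Continuous fun x => torusChar k x * partialDeriv j φ x :=
    (continuous_torusChar k).mul (partialDeriv_mem_torusTest hφ j).1.continuous
  have hc2 : Continuous fun x => Complex.I * k j * (torusChar k x * φ x) :=
    ((continuous_torusChar k).mul hφ.1.continuous).const_mul _
  simp only [h2] at h1
  rw [integral_add (integrableOn_torusBox hc1) (integrableOn_torusBox hc2),
    integral_const_mul] at h1
  rw [torusPairing, torusPairing]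
  linear_combination h1

/-- For $k_j\ne0$, integrating by parts against a constant gives $k_j\int e^{ik\cdot x}\,dx=0$. -/
theorem torusPairing_one (k : Fin 3 → ℤ) :
    torusPairing k (fun _ => 1) = if k = 0 then ((2 * Real.pi : ℝ) : ℂ) ^ 3 else 0 := by
  split_ifs with hk
  · subst hk
    simp [torusPairing, torusChar, volume_torusBox]
  · obtain ⟨j, hj⟩ := Function.ne_iff.1 hk
    have h := torusPairing_partialDeriv k one_mem_torusTest j
    have h0 : partialDeriv j (fun _ => 1) = fun _ => 0 := by
      funext x; simp [partialDeriv]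
    rw [h0] at h
    have h1 : torusPairing k (fun _ => 0) = 0 := by simp [torusPairing]
    rw [h1, eq_comm, mul_eq_zero, neg_eq_zero, mul_eq_zero] at h
    have hj' : (k j : ℂ) ≠ 0 := by exact_mod_cast hj
    simpa [hj'] using h

theorem torusPairing_torusChar (k l : Fin 3 → ℤ) :
    torusPairing k (torusChar l) = if k + l = 0 then ((2 * Real.pi : ℝ) : ℂ) ^ 3 else 0 := by
  rw [← torusPairing_one]
  simp only [torusPairing, torusChar_mul, mul_one]

/-- One integration by parts gains the factor $|k|$ that the $X^{-1}$ norm lacks. -/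
theorem freq_mul_norm_torusPairing_le (k : Fin 3 → ℤ) {φ : (Fin 3 → ℝ) → ℂ} (hφ : φ ∈ torusTest) :
    freq k * ‖torusPairing k φ‖ ≤ ∑ j, ∫ x in torusBox, ‖partialDeriv j φ x‖ := by
  refine (mul_le_mul_of_nonneg_right (freq_le_freqOne k) (norm_nonneg _)).trans ?_
  rw [freqOne, Finset.sum_mul]
  refine Finset.sum_le_sum fun j _ => ?_
  refine le_trans (le_of_eq ?_) (norm_torusPairing_le k _)
  rw [torusPairing_partialDeriv k hφ, norm_mul, norm_neg, norm_mul, Complex.norm_I, one_mul,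
    Complex.norm_intCast]

/-- The operator `1 - Δ`. -/
noncomputable def besselOp (φ : (Fin 3 → ℝ) → ℂ) (x : Fin 3 → ℝ) : ℂ :=
  φ x + -1 * (partialDeriv 0 (partialDeriv 0 φ) x + (partialDeriv 1 (partialDeriv 1 φ) x +
    partialDeriv 2 (partialDeriv 2 φ) x))

theorem besselOp_mem_torusTest {φ : (Fin 3 → ℝ) → ℂ} (hφ : φ ∈ torusTest) :
    besselOp φ ∈ torusTest := by
  have h := fun j => partialDeriv_mem_torusTest (partialDeriv_mem_torusTest hφ j) j
  exact torusTest.add_mem hφ (torusTest.smul_mem (-1)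
    (torusTest.add_mem (h 0) (torusTest.add_mem (h 1) (h 2))))

theorem torusPairing_besselOp (k : Fin 3 → ℤ) {φ : (Fin 3 → ℝ) → ℂ} (hφ : φ ∈ torusTest) :
    torusPairing k (besselOp φ) = (1 + freq k ^ 2 : ℝ) * torusPairing k φ := by
  have h := fun j => (partialDeriv_mem_torusTest (partialDeriv_mem_torusTest hφ j) j).1.continuous
  have e := fun j => torusPairing_partialDeriv k (partialDeriv_mem_torusTest hφ j) j
  simp only [fun j => torusPairing_partialDeriv k hφ j] at e
  have h12 : Continuous fun x => partialDeriv 1 (partialDeriv 1 φ) x +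
      partialDeriv 2 (partialDeriv 2 φ) x := (h 1).add (h 2)
  have h012 : Continuous fun x => -1 * (partialDeriv 0 (partialDeriv 0 φ) x +
      (partialDeriv 1 (partialDeriv 1 φ) x + partialDeriv 2 (partialDeriv 2 φ) x)) :=
    ((h 0).add h12).const_mul (-1)
  unfold besselOp
  rw [torusPairing_add k hφ.1.continuous h012, torusPairing_const_mul,
    torusPairing_add k (h 0) h12, torusPairing_add k (h 1) (h 2), e, e, e, freq_sq, Fin.sum_univ_three]
  push_cast
  linear_combination ((k 0 : ℂ) ^ 2 + (k 1 : ℂ) ^ 2 + (k 2 : ℂ) ^ 2) * torusPairing k φ *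
    (-Complex.I_sq)

/-- Each application of $1-\Delta$ multiplies the pairing by $1+|k|^2$, so smoothness becomes rapid
decay, with no exception at $k=0$. -/
theorem exists_norm_torusPairing_le {φ : (Fin 3 → ℝ) → ℂ} (hφ : φ ∈ torusTest) (m : ℕ) :
    ∃ C, ∀ k, (1 + freq k ^ 2) ^ m * ‖torusPairing k φ‖ ≤ C := by
  have hmem : ∀ m, besselOp^[m] φ ∈ torusTest := by
    intro m
    induction m with
    | zero => exact hφ
    | succ m ih => rw [Function.iterate_succ_apply']; exact besselOp_mem_torusTest ih
  refine ⟨∫ x in torusBox, ‖besselOp^[m] φ x‖, fun k => ?_⟩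
  refine le_trans (le_of_eq ?_) (norm_torusPairing_le k _)
  induction m with
  | zero => simp
  | succ m ih =>
    rw [Function.iterate_succ_apply', torusPairing_besselOp k (hmem m), norm_mul, ← ih,
      Complex.norm_real, Real.norm_of_nonneg (by positivity)]
    ring

/-- Domination by $\prod_j(1+k_j^2)^{-1}$, a product of three convergent series. -/
theorem summable_inv_one_add_freq_sq : Summable fun k : Fin 3 → ℤ => ((1 + freq k ^ 2) ^ 3)⁻¹ := by
  have h1 : Summable fun n : ℤ => (1 + (n : ℝ) ^ 2)⁻¹ := by
    refine Summable.of_norm_bounded_eventually (g := fun n : ℤ => 1 / (n : ℝ) ^ 2)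
      (Real.summable_one_div_int_pow.2 one_lt_two) ?_
    rw [Int.cofinite_eq, eventually_sup]
    have hb : ∀ n : ℤ, n ≠ 0 → ‖(1 + (n : ℝ) ^ 2)⁻¹‖ ≤ 1 / (n : ℝ) ^ 2 := fun n hn => by
      have : (0 : ℝ) < (n : ℝ) ^ 2 := by positivity
      rw [Real.norm_of_nonneg (by positivity), one_div]
      gcongr
      linarith
    exact ⟨(eventually_lt_atBot 0).mono fun n hn => hb n hn.ne,
      (eventually_gt_atTop 0).mono fun n hn => hb n hn.ne'⟩
  have h0 : ∀ n : ℤ, 0 ≤ (1 + (n : ℝ) ^ 2)⁻¹ := fun n => by positivity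
  have h2 := h1.mul_of_nonneg (h1.mul_of_nonneg h1 h0 h0) h0
    (fun p => mul_nonneg (h0 p.1) (h0 p.2))
  have hinj : Function.Injective fun k : Fin 3 → ℤ => (k 0, (k 1, k 2)) := by
    intro k l hkl
    simp only [Prod.mk.injEq] at hkl
    ext j; fin_cases j
    exacts [hkl.1, hkl.2.1, hkl.2.2]
  refine Summable.of_nonneg_of_le (fun k => by positivity) (fun k => ?_) (h2.comp_injective hinj)
  simp only [Function.comp, ← mul_inv]
  rw [freq_sq, Fin.sum_univ_three]
  refine inv_anti₀ (by positivity) ?_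
  have a0 := sq_nonneg (k 0 : ℝ)
  have a1 := sq_nonneg (k 1 : ℝ)
  have a2 := sq_nonneg (k 2 : ℝ)
  rw [pow_three]
  gcongr <;> linarith

theorem summable_torusPairing {φ : (Fin 3 → ℝ) → ℂ} (hφ : φ ∈ torusTest) (N : ℕ) :
    Summable fun k => (1 + freq k ^ 2) ^ N * ‖torusPairing k φ‖ := by
  obtain ⟨C, hC⟩ := exists_norm_torusPairing_le hφ (N + 3)
  refine Summable.of_nonneg_of_le (fun k => by positivity) (fun k => ?_)
    (summable_inv_one_add_freq_sq.mul_left C)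
  rw [← div_eq_mul_inv, le_div_iff₀ (by positivity)]
  refine le_trans (le_of_eq ?_) (hC k)
  ring

theorem eq_of_forall_coe_eq {φ : (Fin 3 → ℝ) → ℂ} (hφ : φ ∈ torusTest) {x y : Fin 3 → ℝ}
    (h : ∀ i, (x i : UnitAddCircle) = y i) : φ ((2 * Real.pi) • x) = φ ((2 * Real.pi) • y) := by
  have hn : ∀ i, ∃ n : ℤ, y i = x i + n := fun i => by
    obtain ⟨n, hn⟩ := AddSubgroup.mem_zmultiples_iff.1 (QuotientAddGroup.eq.1 (h i))
    exact ⟨n, by simp at hn; linarith⟩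
  choose n hn using hn
  have hp : ∀ j, Function.Periodic φ (n j • Pi.single j (2 * Real.pi)) := fun j =>
    Function.Periodic.zsmul (fun x => hφ.2 x j) (n j)
  have : (2 * Real.pi) • y = (2 * Real.pi) • x + n 0 • Pi.single 0 (2 * Real.pi) +
      n 1 • Pi.single 1 (2 * Real.pi) + n 2 • Pi.single 2 (2 * Real.pi) := by
    ext j
    fin_cases j <;> simp [hn] <;> ring
  rw [this, hp, hp, hp]

theorem mFourier_coe (k : Fin 3 → ℤ) (x : Fin 3 → ℝ) :
    UnitAddTorus.mFourier k (fun i => (x i : UnitAddCircle)) = torusChar k ((2 * Real.pi) • x) := by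
  simp only [UnitAddTorus.mFourier, ContinuousMap.coe_mk, fourier_coe_apply, torusChar]
  rw [← Complex.exp_sum]
  congr 1
  push_cast
  rw [Finset.mul_sum]
  refine Finset.sum_congr rfl fun j _ => ?_
  simp
  ring

/-- The Fourier coefficient of a test function. -/
noncomputable def testCoeff (φ : (Fin 3 → ℝ) → ℂ) (k : Fin 3 → ℤ) : ℂ :=
  ((2 * Real.pi : ℝ) : ℂ)⁻¹ ^ 3 * torusPairing (-k) φ

open scoped Pointwise in
theorem setIntegral_unitBox (g : (Fin 3 → ℝ) → ℂ) :
    ∫ x in {x : Fin 3 → ℝ | ∀ i, x i ∈ Set.Ioc ((0 : Fin 3 → ℝ) i) ((0 : Fin 3 → ℝ) i + 1)},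
      g ((2 * Real.pi) • x) = ((2 * Real.pi : ℝ) : ℂ)⁻¹ ^ 3 * ∫ x in torusBox, g x := by
  have hpos : 0 < 2 * Real.pi := by positivity
  rw [Measure.setIntegral_comp_smul_of_pos _ _ _ hpos]
  have h : (2 * Real.pi) • {x : Fin 3 → ℝ | ∀ i, x i ∈ Set.Ioc ((0 : Fin 3 → ℝ) i)
      ((0 : Fin 3 → ℝ) i + 1)} = Set.univ.pi fun i => Set.Ioc ((0 : Fin 3 → ℝ) i)
      ((fun _ => 2 * Real.pi : Fin 3 → ℝ) i) := by
    ext x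
    rw [Set.mem_smul_set_iff_inv_smul_mem₀ hpos.ne']
    simp only [Set.mem_ofPred_eq, Set.mem_pi, Set.mem_univ, true_imp_iff, Pi.smul_apply, smul_eq_mul,
      Set.mem_Ioc, Pi.zero_apply, zero_add]
    refine forall_congr' fun i => and_congr ?_ ?_
    · rw [mul_pos_iff_of_pos_left (inv_pos.2 hpos)]
    · rw [inv_mul_le_iff₀ hpos, mul_one]
  have h' : (Set.univ.pi fun i => Set.Ioc ((0 : Fin 3 → ℝ) i)
      ((fun _ => 2 * Real.pi : Fin 3 → ℝ) i)) =ᵐ[volume] Set.Icc 0 fun _ => 2 * Real.pi :=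
    Measure.univ_pi_Ioc_ae_eq_Icc
  rw [h, torusBox, setIntegral_congr_set h', Complex.real_smul,
    Module.finrank_fin_fun]
  push_cast
  rw [inv_pow]

/-- After rescaling by $2\pi$, $\varphi$ descends to a continuous function on $(\mathbb R/\mathbb
Z)^3$ with absolutely summable coefficients, so its Fourier series converges to it at every point.
-/
theorem hasSum_testCoeff {φ : (Fin 3 → ℝ) → ℂ} (hφ : φ ∈ torusTest) (x : Fin 3 → ℝ) :
    HasSum (fun k => testCoeff φ k * torusChar k x) (φ x) := by
  have hq : IsOpenQuotientMap (Pi.map fun (_ : Fin 3) (y : ℝ) => (y : UnitAddCircle)) :=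
    IsOpenQuotientMap.piMap fun _ => QuotientAddGroup.isOpenQuotientMap_mk
  set p : C(Fin 3 → ℝ, UnitAddTorus (Fin 3)) := ⟨_, hq.continuous⟩
  have hp : IsQuotientMap p := hq.isQuotientMap
  set g : C(Fin 3 → ℝ, ℂ) := ⟨fun y => φ ((2 * Real.pi) • y),
    hφ.1.continuous.comp (continuous_const_smul _)⟩
  have hg : ∀ a b : Fin 3 → ℝ, p a = p b → g a = g b :=
    fun a b hab => eq_of_forall_coe_eq hφ fun i => congrFun hab i
  set F : C(UnitAddTorus (Fin 3), ℂ) := hp.lift g hg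
  have hF : ∀ y : Fin 3 → ℝ, F (fun i => (y i : UnitAddCircle)) = φ ((2 * Real.pi) • y) :=
    fun y => DFunLike.congr_fun (hp.lift_comp g hg) y
  have hcoeff : UnitAddTorus.mFourierCoeff F = testCoeff φ := by
    funext k
    rw [UnitAddTorus.mFourierCoeff_eq_integral F k 0, testCoeff, torusPairing,
      ← setIntegral_unitBox]
    simp only [hF, mFourier_coe, smul_eq_mul]
  have hsum : Summable (testCoeff φ) := by
    refine Summable.of_norm ?_
    have h := (summable_torusPairing hφ 0).comp_injective neg_injective
    simp only [testCoeff, norm_mul]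
    refine Summable.mul_left _ ?_
    simpa [Function.comp_def] using h
  have key := UnitAddTorus.hasSum_mFourier_series_apply_of_summable (f := F)
    (by rwa [hcoeff]) (fun i => (((2 * Real.pi)⁻¹ • x) i : UnitAddCircle))
  have hx : (2 * Real.pi) • ((2 * Real.pi)⁻¹ • x) = x := smul_inv_smul₀ (by positivity) x
  simpa only [hF, mFourier_coe, hcoeff, smul_eq_mul, hx] using key

end TorusFourier

/-! ### Distributions with given Fourier coefficients, and analyticity. -/

section Distributions

open MeasureTheory Filter Topology

/-- The general index type allows tails of Fourier series, indexed by the complement of a finite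
set. -/
theorem norm_iteratedFDeriv_tsum_torusChar_le {ι : Type*} (e : ι → Fin 3 → ℤ) {d : ι → ℂ} {N : ℕ}
    (hd : Summable fun a => (1 + freq (e a) ^ 2) ^ N * ‖d a‖) {n : ℕ} (hn : n ≤ N)
    (x : Fin 3 → ℝ) :
    ‖iteratedFDeriv ℝ n (fun y => ∑' a, d a * torusChar (e a) y) x‖ ≤
      ∑' a, (1 + freq (e a) ^ 2) ^ N * ‖d a‖ := by
  have hle : ∀ m ≤ N, ∀ k, freqOne k ^ m ≤ (1 + freq k ^ 2) ^ N := fun m hm k =>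
    calc freqOne k ^ m ≤ (1 + freq k ^ 2) ^ m :=
          pow_le_pow_left₀ (freqOne_nonneg k) (by linarith [freqOne_le_freq_sq k]) m
      _ ≤ _ := pow_le_pow_right₀ (by linarith [sq_nonneg (freq k)]) hm
  have hcd : ∀ (m : ℕ∞) k, ContDiff ℝ m (torusChar k) := fun m k =>
    (torusChar_mem k).1.of_le (by exact_mod_cast le_top)
  have hb : ∀ (m : ℕ) (a : ι) (y : Fin 3 → ℝ), (m : ℕ∞) ≤ N →
      ‖iteratedFDeriv ℝ m (fun y => d a * torusChar (e a) y) y‖ ≤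
        (1 + freq (e a) ^ 2) ^ N * ‖d a‖ := by
    intro m a y hm
    have : (fun y => d a * torusChar (e a) y) = d a • torusChar (e a) := rfl
    rw [this, iteratedFDeriv_const_smul_apply ((hcd m _).contDiffAt), norm_smul, mul_comm]
    exact mul_le_mul_of_nonneg_right ((norm_iteratedFDeriv_torusChar_le _ m y).trans
      (hle m (by exact_mod_cast hm) _)) (norm_nonneg _)
  rw [iteratedFDeriv_tsum_apply (N := (N : ℕ∞))
    (v := fun _ a => (1 + freq (e a) ^ 2) ^ N * ‖d a‖)
    (fun a => contDiff_const.mul (hcd N (e a))) (fun _ _ => hd) hb (by exact_mod_cast hn) x]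
  exact tsum_of_norm_bounded hd.hasSum fun a => hb n a x (by exact_mod_cast hn)

namespace TorusDistribution

/-- The Fourier series of $\varphi$ converges in every $C^N$ norm, in particular in the one that
controls $f$, so $f$ may be applied term by term. -/
theorem hasSum_testCoeff_mul (f : TorusDistribution) (φ : torusTest) :
    HasSum (fun k => testCoeff φ k * f.toLinearMap ⟨torusChar k, torusChar_mem k⟩)
      (f.toLinearMap φ) := by
  obtain ⟨N, C, hC⟩ := f.bounded
  have hsum : Summable fun k => (1 + freq k ^ 2) ^ N * ‖testCoeff φ k‖ := by
    have h := (summable_torusPairing φ.2 N).comp_injective neg_injective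
    have hneg : ∀ k, freq (-k) = freq k := fun k => by simp [freq]
    simp only [testCoeff, norm_mul, mul_left_comm _ ‖((2 * Real.pi : ℝ) : ℂ)⁻¹ ^ 3‖]
    refine Summable.mul_left _ ?_
    simpa only [Function.comp_def, hneg] using h
  set S : Finset (Fin 3 → ℤ) → torusTest := fun F =>
    ∑ k ∈ F, testCoeff φ k • ⟨torusChar k, torusChar_mem k⟩
  have hS : ∀ F, ((φ - S F : torusTest) : (Fin 3 → ℝ) → ℂ) =
      fun x => ∑' a : {k // k ∉ F}, testCoeff φ a * torusChar a x := by
    intro F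
    funext x
    have h := hasSum_testCoeff φ.2 x
    rw [← sub_eq_of_eq_add' (h.summable.sum_add_tsum_subtype_compl F).symm, h.tsum_eq]
    simp [S, Finset.sum_apply]
  have hbound : ∀ F, ‖f.toLinearMap φ - f.toLinearMap (S F)‖ ≤
      C * ∑' a : {k // k ∉ F}, (1 + freq a ^ 2) ^ N * ‖testCoeff φ a‖ := by
    intro F
    rw [← map_sub]
    refine hC _ _ fun n hn x => ?_
    rw [hS]
    exact norm_iteratedFDeriv_tsum_torusChar_le (fun a : {k // k ∉ F} => (a : Fin 3 → ℤ))
      (hsum.comp_injective Subtype.val_injective) hn x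
  have hlim : Tendsto (fun F => f.toLinearMap (S F)) atTop (𝓝 (f.toLinearMap φ)) := by
    rw [tendsto_iff_norm_sub_tendsto_zero]
    simp only [norm_sub_rev _ (f.toLinearMap φ)]
    refine squeeze_zero (fun _ => norm_nonneg _) hbound ?_
    simpa using (tendsto_tsum_compl_atTop_zero
      fun k => (1 + freq k ^ 2) ^ N * ‖testCoeff φ k‖).const_mul C
  have hSF : ∀ F, f.toLinearMap (S F) =
      ∑ k ∈ F, testCoeff φ k * f.toLinearMap ⟨torusChar k, torusChar_mem k⟩ := fun F => by
    simp only [S, map_sum, map_smul, smul_eq_mul]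
  simp only [hSF] at hlim
  simpa only [HasSum, SummationFilter.unconditional_filter] using hlim

/-- A distribution on the torus is determined by its Fourier coefficients. -/
theorem ext_coeff {f g : TorusDistribution} (h : ∀ k, f.coeff k = g.coeff k) : f = g := by
  have h1 : ∀ k, f.toLinearMap ⟨torusChar k, torusChar_mem k⟩ =
      g.toLinearMap ⟨torusChar k, torusChar_mem k⟩ := by
    intro k
    have := h (-k)
    have hpi : ((2 * Real.pi : ℝ) : ℂ)⁻¹ ^ 3 ≠ 0 :=
      pow_ne_zero _ (inv_ne_zero (by exact_mod_cast Real.two_pi_pos.ne'))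
    simp only [coeff, neg_neg] at this
    exact mul_left_cancel₀ hpi this
  ext φ
  refine (f.hasSum_testCoeff_mul φ).unique ?_
  simpa only [h1] using g.hasSum_testCoeff_mul φ

/-- The summability of coefficients under which `ofCoeff` is defined. -/
def IsCoeff (c : (Fin 3 → ℤ) → ℂ) : Prop := c 0 = 0 ∧ Summable fun k => ‖c k‖ / freq k

theorem IsCoeff.norm_mul_torusPairing_le {c : (Fin 3 → ℤ) → ℂ} (hc : IsCoeff c)
    {φ : (Fin 3 → ℝ) → ℂ} (hφ : φ ∈ torusTest) (k : Fin 3 → ℤ) :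
    ‖c k * torusPairing k φ‖ ≤
      ‖c k‖ / freq k * ∑ j, ∫ x in torusBox, ‖partialDeriv j φ x‖ := by
  rcases eq_or_ne k 0 with rfl | hk
  · simp [hc.1, freq_zero]
  · refine le_trans (le_of_eq ?_) (mul_le_mul_of_nonneg_left (freq_mul_norm_torusPairing_le k hφ)
      (div_nonneg (norm_nonneg _) (freq_nonneg _)))
    have := freq_pos hk
    rw [norm_mul]
    field_simp

theorem IsCoeff.summable {c : (Fin 3 → ℤ) → ℂ} (hc : IsCoeff c) {φ : (Fin 3 → ℝ) → ℂ}
    (hφ : φ ∈ torusTest) : Summable fun k => c k * torusPairing k φ :=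
  Summable.of_norm_bounded (hc.2.mul_right _) (hc.norm_mul_torusPairing_le hφ)

theorem isCoeff_zero : IsCoeff 0 := ⟨rfl, by simp⟩

/-- The distribution with Fourier coefficients `c`. -/
noncomputable def ofIsCoeff (c : (Fin 3 → ℤ) → ℂ) (hc : IsCoeff c) : TorusDistribution where
  toLinearMap :=
    { toFun := fun φ => ∑' k, c k * torusPairing k φ
      map_add' := fun φ ψ => by
        rw [← (hc.summable φ.2).tsum_add (hc.summable ψ.2)]
        refine tsum_congr fun k => ?_
        rw [← mul_add, ← torusPairing_add k φ.2.1.continuous ψ.2.1.continuous]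
        rfl
      map_smul' := fun r φ => by
        rw [RingHom.id_apply, smul_eq_mul, ← tsum_mul_left]
        refine tsum_congr fun k => ?_
        rw [mul_left_comm, ← torusPairing_const_mul k r]
        rfl }
  bounded := by
    -- The distribution has order at most one: each term spends one derivative of $\varphi$. The
    -- factor $3(2\pi)^3$ is three partial derivatives integrated over the box.
    refine ⟨1, (∑' k, ‖c k‖ / freq k) * (3 * (2 * Real.pi) ^ 3), fun φ M hM => ?_⟩
    have h1 : ∀ j x, ‖partialDeriv j φ x‖ ≤ M := by
      intro j x
      have h := hM 1 le_rfl x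
      rw [norm_iteratedFDeriv_one] at h
      refine (ContinuousLinearMap.le_opNorm _ _).trans ?_
      rwa [Pi.norm_single, norm_one, mul_one]
    have h2 : ∑ j, ∫ x in torusBox, ‖partialDeriv j φ x‖ ≤ 3 * (2 * Real.pi) ^ 3 * M := by
      calc _ ≤ ∑ j : Fin 3, ∫ x in torusBox, M := by
            refine Finset.sum_le_sum fun j _ => integral_mono ?_ ?_ (h1 j)
            · exact (integrableOn_torusBox (partialDeriv_mem_torusTest φ.2 j).1.continuous).norm
            · exact integrableOn_const (isCompact_torusBox.measure_lt_top.ne)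
        _ = _ := by simp [volume_torusBox, mul_assoc]
    refine (tsum_of_norm_bounded (hc.2.mul_right _).hasSum
      (hc.norm_mul_torusPairing_le φ.2)).trans ?_
    rw [tsum_mul_right, mul_assoc]
    exact mul_le_mul_of_nonneg_left h2
      (tsum_nonneg fun k => div_nonneg (norm_nonneg _) (freq_nonneg k))

open scoped Classical in
/-- The distribution with Fourier coefficients `c` if these satisfy `IsCoeff`, and `0` otherwise. -/
noncomputable def ofCoeff (c : (Fin 3 → ℤ) → ℂ) : TorusDistribution :=
  if hc : IsCoeff c then ofIsCoeff c hc else ofIsCoeff 0 isCoeff_zero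

theorem ofCoeff_apply {c : (Fin 3 → ℤ) → ℂ} (hc : IsCoeff c) (φ : torusTest) :
    (ofCoeff c).toLinearMap φ = ∑' k, c k * torusPairing k φ := by
  rw [ofCoeff, dif_pos hc]; rfl

theorem coeff_ofCoeff {c : (Fin 3 → ℤ) → ℂ} (hc : IsCoeff c) (k : Fin 3 → ℤ) :
    (ofCoeff c).coeff k = c k := by
  rw [coeff, ofCoeff_apply hc]
  simp only [torusPairing_torusChar]
  rw [tsum_eq_single k fun l hl => by rw [if_neg (by rwa [← sub_eq_add_neg, sub_eq_zero]), mul_zero]]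
  have hpi : ((2 * Real.pi : ℝ) : ℂ) ≠ 0 := by exact_mod_cast Real.two_pi_pos.ne'
  rw [if_pos (by simp), inv_pow]
  field_simp

theorem isFunction_ofCoeff {c : (Fin 3 → ℤ) → ℂ} (hc : IsCoeff c) (hs : Summable fun k => ‖c k‖) :
    (ofCoeff c).IsFunction fun x => ∑' k, c k * torusChar k x := by
  refine ⟨?_, fun x j => ?_, fun φ => ?_⟩
  · refine continuous_tsum (fun k => continuous_const.mul (continuous_torusChar k)) hs fun k x => ?_
    rw [norm_mul, norm_torusChar, mul_one]
  · exact tsum_congr fun k => by rw [(torusChar_mem k).2 x j]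
  · rw [ofCoeff_apply hc]
    have hφ : Continuous (φ : (Fin 3 → ℝ) → ℂ) := φ.2.1.continuous
    have hi : ∀ k, Integrable (fun x => c k * (torusChar k x * (φ : (Fin 3 → ℝ) → ℂ) x))
        (volume.restrict torusBox) := fun k =>
      integrableOn_torusBox (continuous_const.mul ((continuous_torusChar k).mul hφ))
    have hn : ∀ k, ∫ x in torusBox, ‖c k * (torusChar k x * (φ : (Fin 3 → ℝ) → ℂ) x)‖ =
        ‖c k‖ * ∫ x in torusBox, ‖(φ : (Fin 3 → ℝ) → ℂ) x‖ := fun k => by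
      simp only [norm_mul, norm_torusChar, one_mul]
      exact integral_const_mul _ _
    have h := hasSum_integral_of_summable_integral_norm hi (by
      simp only [hn]
      exact hs.mul_right _)
    simp only [integral_const_mul] at h
    refine h.tsum_eq.trans (integral_congr_ae (.of_forall fun x => ?_))
    simp only [← mul_assoc]
    exact tsum_mul_right

/-- The complex linear form `z ↦ k·z`. -/
noncomputable def complexForm (k : Fin 3 → ℤ) : (Fin 3 → ℂ) →L[ℂ] ℂ :=
  ∑ j, (k j : ℂ) • ContinuousLinearMap.proj j

theorem complexForm_apply (k : Fin 3 → ℤ) (z : Fin 3 → ℂ) :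
    complexForm k z = ∑ j, (k j : ℂ) * z j := by
  simp [complexForm]

theorem norm_complexForm_le (k : Fin 3 → ℤ) : ‖complexForm k‖ ≤ freqOne k := by
  refine ContinuousLinearMap.opNorm_le_bound _ (freqOne_nonneg k) fun x => ?_
  rw [complexForm_apply, freqOne, Finset.sum_mul]
  refine norm_sum_le_of_le _ fun j _ => ?_
  rw [norm_mul, Complex.norm_intCast]
  exact mul_le_mul_of_nonneg_left (norm_le_pi_norm x j) (abs_nonneg _)

theorem norm_exp_complexForm_le (k : Fin 3 → ℤ) {z : Fin 3 → ℂ} {r : ℝ} (hz : ∀ j, |(z j).im| < r) :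
    ‖Complex.exp (Complex.I * complexForm k z)‖ ≤ Real.exp (r * freqOne k) := by
  rw [Complex.norm_exp, Real.exp_le_exp, complexForm_apply, freqOne, Finset.mul_sum, Finset.mul_sum,
    Complex.re_sum]
  refine Finset.sum_le_sum fun j _ => ?_
  have : (Complex.I * ((k j : ℂ) * z j)).re = -((k j : ℝ) * (z j).im) := by simp
  rw [this]
  calc -((k j : ℝ) * (z j).im) ≤ |(k j : ℝ) * (z j).im| := neg_le_abs _
    _ = |(z j).im| * |(k j : ℝ)| := by rw [abs_mul, mul_comm]
    _ ≤ r * |(k j : ℝ)| := mul_le_mul_of_nonneg_right (hz j).le (abs_nonneg _)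

theorem sq_mul_exp_neg_le {ε x : ℝ} (hε : 0 < ε) (hx : 0 ≤ x) :
    x ^ 2 * Real.exp (-(ε * x)) ≤ 2 / ε ^ 2 := by
  have h := Real.pow_div_factorial_le_exp (ε * x) (by positivity) 2
  rw [Real.exp_neg, ← div_eq_mul_inv, div_le_div_iff₀ (Real.exp_pos _) (by positivity)]
  norm_num at h
  nlinarith

/-- Shrinking the radius from $R$ to $r$ frees a factor $e^{-(R-r)|k|_1}$. It pays for two powers of
the frequency: the $1/|k|$ in the norm, and one derivative of the series. -/
theorem norm_mul_exp_mul_freqOne_le {c : (Fin 3 → ℤ) → ℂ} (h0 : c 0 = 0) {r R : ℝ} (hr : r < R)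
    (k : Fin 3 → ℤ) :
    ‖c k‖ * Real.exp (r * freqOne k) * freqOne k ≤
      2 / (R - r) ^ 2 * (Real.exp (R * freqOne k) * ‖c k‖ / freq k) := by
  rcases eq_or_ne k 0 with rfl | hk
  · simp [h0]
  have hf := freq_pos hk
  have hf1 := freqOne_nonneg k
  have h := sq_mul_exp_neg_le (sub_pos.2 hr) hf1
  have he : Real.exp (r * freqOne k) =
      Real.exp (R * freqOne k) * Real.exp (-((R - r) * freqOne k)) := by
    rw [← Real.exp_add]; ring_nf
  have hle : freq k * freqOne k ≤ freqOne k ^ 2 := by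
    rw [sq]; exact mul_le_mul_of_nonneg_right (freq_le_freqOne k) hf1
  rw [he, mul_div_assoc', le_div_iff₀ hf]
  calc _ = Real.exp (R * freqOne k) * ‖c k‖ *
        (freq k * freqOne k * Real.exp (-((R - r) * freqOne k))) := by ring
    _ ≤ Real.exp (R * freqOne k) * ‖c k‖ * (2 / (R - r) ^ 2) := by
        refine mul_le_mul_of_nonneg_left (le_trans ?_ h) (by positivity)
        exact mul_le_mul_of_nonneg_right hle (Real.exp_pos _).le
    _ = _ := by ring

/-- Exponentially decaying Fourier coefficients belong to a real-analytic function. -/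
theorem analyticWithRadius_ofCoeff {c : (Fin 3 → ℤ) → ℂ} (hc : IsCoeff c) {R : ℝ} (hR : 0 < R)
    (hs : Summable fun k => Real.exp (R * freqOne k) * ‖c k‖ / freq k) :
    (ofCoeff c).AnalyticWithRadius R := by
  have hsum : ∀ r < R, Summable fun k => ‖c k‖ * Real.exp (r * freqOne k) * freqOne k := fun r hr =>
    Summable.of_nonneg_of_le (fun k => mul_nonneg (by positivity) (freqOne_nonneg k))
      (norm_mul_exp_mul_freqOne_le hc.1 hr) (hs.mul_left _)
  have hnorm : Summable fun k => ‖c k‖ := by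
    refine Summable.of_nonneg_of_le (fun k => norm_nonneg _) (fun k => ?_) (hsum 0 hR)
    rcases eq_or_ne k 0 with rfl | hk
    · simp [hc.1]
    · rw [zero_mul, Real.exp_zero, mul_one]
      exact le_mul_of_one_le_right (norm_nonneg _) ((one_le_freq hk).trans (freq_le_freqOne k))
  refine ⟨fun z => ∑' k, c k * Complex.exp (Complex.I * complexForm k z), ?_, ?_⟩
  · intro z hz
    -- Termwise differentiation needs a summable bound, available on each smaller tube. That tube is
    -- convex, hence connected, and convergence at $0$ starts the argument.
    obtain ⟨r, hzr, hrR⟩ : ∃ r, (∀ j, |(z j).im| < r) ∧ r < R := by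
      obtain ⟨j₀, hj₀⟩ := Finite.exists_max fun j => |(z j).im|
      obtain ⟨r, h1, h2⟩ := exists_between (hz j₀)
      exact ⟨r, fun j => (hj₀ j).trans_lt h1, h2⟩
    set T : Set (Fin 3 → ℂ) := {z | ∀ j, |(z j).im| < r}
    have hT : T = ⋂ j, {z : Fin 3 → ℂ | |(z j).im| < r} := by ext; simp [T]
    have hTo : IsOpen T := by
      rw [hT]
      exact isOpen_iInter_of_finite fun j => isOpen_lt (by fun_prop) continuous_const
    have hTc : Convex ℝ T := by
      intro x hx y hy a b ha hb hab j
      have h1 : ((a • x + b • y) j).im = a * (x j).im + b * (y j).im := by simp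
      rw [h1]
      refine (abs_add_le _ _).trans_lt ?_
      rw [abs_mul, abs_mul, abs_of_nonneg ha, abs_of_nonneg hb]
      rcases ha.eq_or_lt with rfl | ha
      · have : b = 1 := by linarith
        subst this; simpa using hy j
      · nlinarith [mul_lt_mul_of_pos_left (hx j) ha, mul_le_mul_of_nonneg_left (hy j).le hb]
    have h0T : (0 : Fin 3 → ℂ) ∈ T := fun j => by
      simpa using (abs_nonneg _).trans_lt (hzr j)
    have hder : ∀ k, ∀ w ∈ T, HasFDerivAt (fun w => c k * Complex.exp (Complex.I * complexForm k w))
        (c k • (Complex.exp (Complex.I * complexForm k w) • (Complex.I • complexForm k))) w :=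
      fun k w _ => (((complexForm k).hasFDerivAt.const_mul Complex.I).cexp).const_mul (c k)
    have hbd : ∀ k, ∀ w ∈ T,
        ‖c k • (Complex.exp (Complex.I * complexForm k w) • (Complex.I • complexForm k))‖ ≤
          ‖c k‖ * Real.exp (r * freqOne k) * freqOne k := by
      intro k w hw
      rw [norm_smul, norm_smul, norm_smul, Complex.norm_I, one_mul, mul_assoc]
      exact mul_le_mul_of_nonneg_left (mul_le_mul (norm_exp_complexForm_le k hw)
        (norm_complexForm_le k) (norm_nonneg _) (Real.exp_pos _).le) (norm_nonneg _)
    exact (hasFDerivAt_tsum_of_isPreconnected (hsum r hrR) hTo hTc.isPreconnected hder hbd h0T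
      (by simpa using hnorm.of_norm) hzr).differentiableAt.differentiableWithinAt
  · have h : (fun x : Fin 3 → ℝ => ∑' k, c k *
        Complex.exp (Complex.I * complexForm k fun j => (x j : ℂ))) =
        fun x => ∑' k, c k * torusChar k x := by
      funext x
      refine tsum_congr fun k => ?_
      rw [torusChar, complexForm_apply]
      push_cast
      rfl
    rw [h]
    exact isFunction_ofCoeff hc hnorm

end TorusDistribution

end Distributions

/-! ### From coefficients back to fields. -/

section MildSolutions

open MeasureTheory Filter Topology

theorem ofReal_div_freq {y : ℝ} {k : Fin 3 → ℤ} (hk : k ≠ 0) :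
    ENNReal.ofReal (y / freq k) = ENNReal.ofReal y / efreq k :=
  ENNReal.ofReal_div_of_pos (freq_pos hk)

theorem normX_eq (f : TorusField) : normX f = xNorm f.coeff :=
  tsum_congr fun k => by rw [ofReal_div_freq k.2, ofReal_norm]

theorem normY_eq (f : ℝ → TorusField) : normY f = yNorm fun t k => ‖(f t).coeff k‖ₑ := by
  refine congrArg₂ (· + ·) (tsum_congr fun k => iSup_congr fun t => ?_) (tsum_congr fun k => ?_)
  · rw [ofReal_div_freq k.2, ofReal_norm]
  · simp only [ENNReal.ofReal_mul (freq_nonneg _), ofReal_norm]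
    rfl

theorem summable_div_freq {g : (Fin 3 → ℤ) → ℝ} (hg : ∀ k, 0 ≤ g k)
    (h : ∑' k : {k : Fin 3 → ℤ // k ≠ 0}, ENNReal.ofReal (g k) / efreq k ≠ ⊤) :
    Summable fun k => g k / freq k := by
  have h1 : ∑' k : {k : Fin 3 → ℤ // k ≠ 0}, ENNReal.ofReal (g k / freq k) ≠ ⊤ := by
    rwa [tsum_congr fun k : {k : Fin 3 → ℤ // k ≠ 0} => ofReal_div_freq k.2]
  rw [tsum_ne_zero_eq_tsum (fun k => ENNReal.ofReal (g k / freq k)) (by simp [freq_zero])] at h1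
  refine (ENNReal.summable_toReal h1).congr fun k => ?_
  exact ENNReal.toReal_ofReal (div_nonneg (hg k) (freq_nonneg k))

/-- The vector field with given Fourier coefficients. -/
noncomputable def TorusField.ofCoeff (b : (Fin 3 → ℤ) → EuclideanSpace ℂ (Fin 3)) : TorusField :=
  fun i => TorusDistribution.ofCoeff fun k => b k i

theorem isCoeff_coord {b : (Fin 3 → ℤ) → EuclideanSpace ℂ (Fin 3)} (h0 : b 0 = 0)
    (h : xNorm b < ⊤) (i : Fin 3) : TorusDistribution.IsCoeff fun k => b k i := by
  refine ⟨by simp [h0], ?_⟩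
  have h1 : Summable fun k => ‖b k‖ / freq k :=
    summable_div_freq (fun k => norm_nonneg _) (by simp only [ofReal_norm]; exact h.ne)
  exact Summable.of_nonneg_of_le (fun k => div_nonneg (norm_nonneg _) (freq_nonneg k))
    (fun k => div_le_div_of_nonneg_right (PiLp.norm_apply_le _ i) (freq_nonneg k)) h1

theorem TorusField.coeff_ofCoeff {b : (Fin 3 → ℤ) → EuclideanSpace ℂ (Fin 3)} (h0 : b 0 = 0)
    (h : xNorm b < ⊤) (k : Fin 3 → ℤ) : (TorusField.ofCoeff b).coeff k = b k := by
  ext i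
  exact TorusDistribution.coeff_ofCoeff (isCoeff_coord h0 h i) k

namespace MemYCoeff

variable {b : ℝ → (Fin 3 → ℤ) → EuclideanSpace ℂ (Fin 3)}

theorem xNorm_lt_top (hb : MemYCoeff b) {t : ℝ} (ht : 0 ≤ t) : xNorm (b t) < ⊤ :=
  (tsum_div_efreq_le (fun t k => ‖b t k‖ₑ) ht).trans_lt hb.lt_top

theorem coeff_ofCoeff (hb : MemYCoeff b) {t : ℝ} (ht : 0 ≤ t) (k : Fin 3 → ℤ) :
    (TorusField.ofCoeff (b t)).coeff k = b t k :=
  TorusField.coeff_ofCoeff (hb.zero t ht) (hb.xNorm_lt_top ht) k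

theorem normY_ofCoeff (hb : MemYCoeff b) :
    normY (fun t => TorusField.ofCoeff (b t)) = yNorm fun t k => ‖b t k‖ₑ := by
  rw [normY_eq]
  exact le_antisymm (yNorm_mono fun t ht k _ => by rw [hb.coeff_ofCoeff ht])
    (yNorm_mono fun t ht k _ => by rw [hb.coeff_ofCoeff ht])

theorem memY_ofCoeff (hb : MemYCoeff b) : MemY fun t => TorusField.ofCoeff (b t) where
  aemeasurable k := (hb.aemeasurable k).congr ((ae_restrict_mem measurableSet_Ici).mono
    fun t ht => (hb.coeff_ofCoeff ht k).symm)
  coeff_zero t ht := by rw [hb.coeff_ofCoeff ht, hb.zero t ht]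
  normY_lt_top := by rw [hb.normY_ofCoeff]; exact hb.lt_top

end MemYCoeff

theorem MemY.memYCoeff {v : ℝ → TorusField} (hv : MemY v) : MemYCoeff fun t => (v t).coeff where
  aemeasurable := hv.aemeasurable
  zero := hv.coeff_zero
  lt_top := by rw [← normY_eq]; exact hv.normY_lt_top

theorem IsMildSolution.eq_mildMap {μ : ℝ} {v₀ : TorusField} {v : ℝ → TorusField}
    (hv : IsMildSolution μ v₀ v) {t : ℝ} (ht : 0 ≤ t) (k : Fin 3 → ℤ) :
    (v t).coeff k = mildMap μ v₀.coeff (fun t => (v t).coeff) t k := by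
  ext i
  exact hv.formula t ht k i

theorem isMildSolution_ofCoeff {μ : ℝ} {v₀ : TorusField}
    {a : ℝ → (Fin 3 → ℤ) → EuclideanSpace ℂ (Fin 3)} (ha : MemYCoeff a)
    (hfix : ∀ t, 0 ≤ t → ∀ k, a t k = mildMap μ v₀.coeff a t k) :
    IsMildSolution μ v₀ fun t => TorusField.ofCoeff (a t) where
  memY := ha.memY_ofCoeff
  formula t ht k i := by
    have h1 : (TorusField.ofCoeff (a t) i).coeff k = mildMap μ v₀.coeff a t k i := by
      rw [← hfix t ht k, ← ha.coeff_ofCoeff ht k]; rfl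
    rw [h1]
    refine congrArg₂ (· - ·) rfl (intervalIntegral.integral_congr fun s hs => ?_)
    rw [Set.uIcc_of_le ht] at hs
    -- Available because the Duhamel integral only involves times $s\ge0$.
    have h2 : (TorusField.ofCoeff (a s)).coeff = a s := funext fun k => ha.coeff_ofCoeff hs.1 k
    have h3 : leraySymbol k (divTensorCoeff (TorusField.ofCoeff (a s)) k) i =
        nonlinCoeff (TorusField.ofCoeff (a s)).coeff k i := rfl
    rw [h3, h2]
    rfl

/-- Multiplication of the Fourier coefficients by `e^{ρ(t)|k|₁}`. -/
noncomputable def weightCoeff (ρ : ℝ → ℝ) (a : ℝ → (Fin 3 → ℤ) → EuclideanSpace ℂ (Fin 3)) (t : ℝ)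
    (k : Fin 3 → ℤ) : EuclideanSpace ℂ (Fin 3) :=
  (Real.exp (ρ t * freqOne k) : ℂ) • a t k

theorem enorm_weightCoeff (ρ : ℝ → ℝ) (a : ℝ → (Fin 3 → ℤ) → EuclideanSpace ℂ (Fin 3)) (t : ℝ)
    (k : Fin 3 → ℤ) : ‖weightCoeff ρ a t k‖ₑ = expWeight ρ t k * ‖a t k‖ₑ := by
  rw [weightCoeff, enorm_smul, enorm_exp_ofReal, expWeight]

theorem MemYCoeff.weightCoeff {ρ : ℝ → ℝ} (hρ : Measurable ρ)
    {a : ℝ → (Fin 3 → ℤ) → EuclideanSpace ℂ (Fin 3)} (ha : MemYCoeff a) (h : wNorm ρ a < ⊤) :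
    MemYCoeff (weightCoeff ρ a) where
  aemeasurable k := by
    have hm : Measurable fun t => (Real.exp (ρ t * freqOne k) : ℂ) := by fun_prop
    exact hm.aemeasurable.smul (ha.aemeasurable k)
  zero t ht := by simp [_root_.weightCoeff, ha.zero t ht]
  lt_top := by simp only [enorm_weightCoeff]; exact h

theorem MemYCoeff.isExpD {ρ : ℝ → ℝ} (hρ : Measurable ρ)
    {a : ℝ → (Fin 3 → ℤ) → EuclideanSpace ℂ (Fin 3)} (ha : MemYCoeff a) (h : wNorm ρ a < ⊤) :
    IsExpD ρ (fun t => TorusField.ofCoeff (a t))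
      (fun t => TorusField.ofCoeff (_root_.weightCoeff ρ a t)) := fun t ht k => by
  rw [(ha.weightCoeff hρ h).coeff_ofCoeff ht, ha.coeff_ofCoeff ht]
  rfl

theorem MemYCoeff.analyticWithRadius {ρ : ℝ → ℝ}
    {a : ℝ → (Fin 3 → ℤ) → EuclideanSpace ℂ (Fin 3)} (ha : MemYCoeff a) (h : wNorm ρ a < ⊤)
    {t : ℝ} (ht : 0 ≤ t) (hρ : 0 < ρ t) (i : Fin 3) :
    (TorusField.ofCoeff (a t) i).AnalyticWithRadius (ρ t) := by
  refine TorusDistribution.analyticWithRadius_ofCoeff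
    (isCoeff_coord (ha.zero t ht) (ha.xNorm_lt_top ht) i) hρ ?_
  have h1 : Summable fun k => Real.exp (ρ t * freqOne k) * ‖a t k‖ / freq k := by
    refine summable_div_freq (fun k => by positivity) (ne_top_of_le_ne_top h.ne ?_)
    simp only [ENNReal.ofReal_mul (Real.exp_pos _).le, ofReal_norm]
    exact tsum_div_efreq_le (fun t k => expWeight ρ t k * ‖a t k‖ₑ) ht
  refine Summable.of_nonneg_of_le (fun k => div_nonneg (by positivity) (freq_nonneg k))
    (fun k => div_le_div_of_nonneg_right ?_ (freq_nonneg k)) h1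
  exact mul_le_mul_of_nonneg_left (PiLp.norm_apply_le _ i) (Real.exp_pos _).le

/-- A mild solution of small norm is unique. -/
theorem IsMildSolution.eq_of_normY_le {μ : ℝ} (hμ : 0 < μ) {v₀ : TorusField} {v w : ℝ → TorusField}
    (hv : IsMildSolution μ v₀ v) (hw : IsMildSolution μ v₀ w) {M : ℝ≥0∞} (hvM : normY v ≤ M)
    (hwM : normY w ≤ M) (hM : 144 * linConst 0 μ * M ≤ 1) {t : ℝ} (ht : 0 ≤ t) : w t = v t := by
  rw [normY_eq] at hvM hwM
  funext i
  refine TorusDistribution.ext_coeff fun k => ?_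
  have h := eq_of_mildMap_fixed hμ v₀.coeff hw.memY.memYCoeff hv.memY.memYCoeff hwM hvM hM
    (fun t ht k => hw.eq_mildMap ht k) (fun t ht k => hv.eq_mildMap ht k) ht k
  exact congrArg (fun x : EuclideanSpace ℂ (Fin 3) => x i) h

end MildSolutions

/-! ### Choice of the constants and conclusion. -/

theorem theorem2 (μ : ℝ) (hμ : 0 < μ) :
    ∃ (K : ℝ≥0) (δ : ℝ≥0), 0 < δ ∧ ∀ α ∈ Set.Ioo (0 : ℝ) 1,
      ∃ (C : ℝ≥0) (ε₀ : ℝ≥0), 0 < ε₀ ∧ ∀ v₀ : TorusField, MemX v₀ → normX v₀ < ε₀ →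
        ∃ v : ℝ → TorusField,
          (IsMildSolution μ v₀ v ∧ normY v ≤ K * normX v₀ ∧ normY v < δ ∧
            ∀ w : ℝ → TorusField, IsMildSolution μ v₀ w → normY w < δ →
              ∀ t : ℝ, 0 ≤ t → w t = v t) ∧
          (∃ V₁ V₂ : ℝ → TorusField, MemY V₁ ∧ MemY V₂ ∧
            IsExpD (fun t => μ * Real.sqrt t) v V₁ ∧ IsExpD (fun t => α * μ * t) v V₂ ∧
            normY V₁ + normY V₂ ≤ C * normX v₀) ∧
          ∀ t : ℝ, 0 < t → ∀ i : Fin 3,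
            (v t i).AnalyticWithRadius (max (μ * Real.sqrt t) (α * μ * t)) := by
  obtain ⟨A₀, hA₀⟩ : ∃ A : ℝ≥0, (A : ℝ≥0∞) = _ :=
    ⟨_, ENNReal.coe_toNNReal (linConst_lt_top 0 μ).ne⟩
  have hA₀pos : 0 < A₀ := by
    rw [pos_iff_ne_zero]; rintro rfl; exact linConst_ne_zero 0 μ hA₀.symm
  -- Both constants involve only the unweighted estimate, hence not $\alpha$. This $\delta$ is the
  -- radius at which the mild map has Lipschitz constant $1/2$.
  refine ⟨2 * A₀, (144 * A₀)⁻¹, by positivity, fun α hα => ?_⟩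
  obtain ⟨A₁, hA₁⟩ : ∃ A : ℝ≥0, (A : ℝ≥0∞) = _ :=
    ⟨_, ENNReal.coe_toNNReal (linConst_lt_top (3 / 2 * μ) (μ / 2)).ne⟩
  obtain ⟨A₂, hA₂⟩ : ∃ A : ℝ≥0, (A : ℝ≥0∞) = _ :=
    ⟨_, ENNReal.coe_toNNReal (linConst_lt_top 0 ((1 - α) * μ)).ne⟩
  -- The sum of squares dominates each $A_i^2$, so one threshold serves all three weights; $288$
  -- rather than $144$ puts $2A_0\|v_0\|$ strictly below $\delta$.
  refine ⟨2 * A₁ + 2 * A₂, (288 * (A₀ ^ 2 + A₁ ^ 2 + A₂ ^ 2))⁻¹, by positivity,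
    fun v₀ hv₀ hsmall => ?_⟩
  rw [normX_eq] at hsmall ⊢
  have hx0 : v₀.coeff 0 = 0 := hv₀.1
  have hx : xNorm v₀.coeff < ⊤ := hsmall.trans ENNReal.coe_lt_top
  obtain ⟨X, hX⟩ : ∃ A : ℝ≥0, (A : ℝ≥0∞) = _ :=
    ⟨_, ENNReal.coe_toNNReal hx.ne⟩
  rw [← hX, ENNReal.coe_lt_coe, ← one_div, lt_div_iff₀ (by positivity)] at hsmall
  have hs : ∀ A : ℝ≥0, A ^ 2 ≤ A₀ ^ 2 + A₁ ^ 2 + A₂ ^ 2 → 288 * A ^ 2 * X < 1 := fun A hA =>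
    lt_of_le_of_lt (by rw [mul_comm X]; gcongr) hsmall
  have hs₀ : 288 * A₀ ^ 2 * X < 1 := hs A₀ (by rw [add_assoc]; exact le_self_add)
  have hs' : ∀ A : ℝ≥0, 288 * A ^ 2 * X < 1 → 144 * (A : ℝ≥0∞) ^ 2 * xNorm v₀.coeff ≤ 1 := by
    intro A hA
    rw [← hX]
    have : 144 * A ^ 2 * X ≤ 1 := le_trans (by gcongr; norm_num) hA.le
    exact_mod_cast this
  obtain ⟨a, ha, hfix, hbound⟩ := exists_mildMap_fixed hμ hx0 hx (by
    rw [← hA₀, ← hX]; exact_mod_cast hs₀.le)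
  have hw₀ := hbound _ _ _ (isAbsorbed_zero hμ) (by rw [← hA₀]; exact hs' A₀ hs₀)
  have hw₁ := hbound _ _ _ (isAbsorbed_sqrt hμ) (by
    rw [← hA₁]
    exact hs' A₁ (hs A₁ (le_add_right le_add_self)))
  have hw₂ := hbound _ _ _ (isAbsorbed_linear hμ hα) (by
    rw [← hA₂]
    exact hs' A₂ (hs A₂ le_add_self))
  have hfin : ∀ A : ℝ≥0, 2 * (A * xNorm v₀.coeff) < ⊤ := fun A =>
    ENNReal.mul_lt_top (by simp) (ENNReal.mul_lt_top ENNReal.coe_lt_top hx)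
  rw [← hA₀, wNorm_zero_weight, ← ha.normY_ofCoeff] at hw₀
  rw [← hA₁] at hw₁
  rw [← hA₂] at hw₂
  have hmild := isMildSolution_ofCoeff ha hfix
  have hδ : normY (fun t => TorusField.ofCoeff (a t)) < ((144 * A₀)⁻¹ : ℝ≥0) := by
    refine hw₀.trans_lt ?_
    rw [← hX]
    have : 2 * (A₀ * X) < (144 * A₀)⁻¹ := by
      rw [← one_div, lt_div_iff₀ (by positivity)]
      refine lt_of_eq_of_lt ?_ hs₀
      ring
    exact_mod_cast this
  have hM : 144 * linConst 0 μ * ((144 * A₀)⁻¹ : ℝ≥0) ≤ 1 := by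
    rw [← hA₀]
    have : 144 * A₀ * (144 * A₀)⁻¹ ≤ 1 := (mul_inv_cancel₀ (by positivity)).le
    exact_mod_cast this
  have hW₁ := hw₁.trans_lt (hfin A₁)
  have hW₂ := hw₂.trans_lt (hfin A₂)
  have hρ₁ := (isAbsorbed_sqrt hμ).measurable
  have hρ₂ := (isAbsorbed_linear hμ hα).measurable
  refine ⟨fun t => TorusField.ofCoeff (a t), ⟨hmild, ?_, hδ, fun w hw hwδ t ht =>
    hmild.eq_of_normY_le hμ hw hδ.le hwδ.le hM ht⟩, ⟨_, _, (ha.weightCoeff hρ₁ hW₁).memY_ofCoeff,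
    (ha.weightCoeff hρ₂ hW₂).memY_ofCoeff, ha.isExpD hρ₁ hW₁, ha.isExpD hρ₂ hW₂, ?_⟩, ?_⟩
  · refine hw₀.trans (le_of_eq ?_)
    push_cast
    ring
  · rw [(ha.weightCoeff hρ₁ hW₁).normY_ofCoeff, (ha.weightCoeff hρ₂ hW₂).normY_ofCoeff]
    simp only [enorm_weightCoeff]
    refine (add_le_add hw₁ hw₂).trans (le_of_eq ?_)
    push_cast
    ring
  · intro t ht i
    have hα0 := hα.1
    -- The maximum is one of the two radii, and the corresponding weighted bound applies.
    rcases le_total (μ * Real.sqrt t) (α * μ * t) with h | h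
    · rw [max_eq_right h]
      exact ha.analyticWithRadius hW₂ ht.le (by positivity) i
    · rw [max_eq_left h]
      have := Real.sqrt_pos.2 ht
      exact ha.analyticWithRadius hW₁ ht.le (by positivity) i
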